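/- Throughout, $|\cdot|$ is the Euclidean norm on $\mathbb{R}^2$, $J_m$ and $H^{(1)}_m$ ($m\in\mathbb{Z}$) are the Bessel function and the Hankel function of the first kind (principal branch, cut along $(-\infty,0]$), $\arg v$ is the counter-clockwise polar angle of $v\in\mathbb{R}^2$, and $$G(v;k)=\frac{i}{4}H^{(1)}_0(k|v|),\qquad v\in\mathbb{R}^2\setminus\{0\},\ k\in\mathbb{C}\setminus(-\infty,0].$$ For $x_j\in\mathbb{R}^2$ and $M\in\mathbb{N}$ put $$G_{j,M}(x,y;k)=\frac{i}{4}\sum_{m=-M}^{M}H^{(1)}_m(k|x-x_j|)\,J_m(k|y-x_j|)\,e^{im(\arg(x-x_j)-\arg(y-x_j))},$$ where at $y=x_j$ the terms with $m\neq0$ are read as $0$. **Theorem.** Let $x_j\in\mathbb{R}^2$, let $Y\subset\mathbb{R}^2$ be a nonempty compact set, let $X\subset\mathbb{R}^2$ be a compact set disjoint from the closed disk $\{x\in\mathbb{R}^2:\ |x-x_j|\le\max_{y\in Y}|y-x_j|\}$, and let $K\subset\mathbb{C}\setminus(-\infty,0]$ be compact. For $x\in X$ put $$a_x=\frac{\max_{y\in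 Y}|y-x_j|}{|x-x_j|}.$$ Then there are constants $C_1,C_2>0$, depending only on $x_j$, $X$, $Y$ and $K$, such that for all integers $M\ge2$, all $x\in X$, $k\in K$, $y\in Y$ and all unit vectors $\nu\in\mathbb{R}^2$, the functions $y'\mapsto G(x-y';k)$ and $y'\mapsto G_{j,M}(x,y';k)$ are differentiable at $y$ and $$\big|G(x-y;k)-G_{j,M}(x,y;k)\big|\le C_1\Big(-\ln(1-a_x)-\sum_{m=1}^{M}\frac{a_x^m}{m}\Big),$$ $$\Big|\frac{\partial}{\partial\nu(y)}\big[G(x-y;k)-G_{j,M}(x,y;k)\big]\Big|\le C_2\,\frac{a_x^{M+1}}{1-a_x},$$ where $\partial/\partial\nu(y)$ is the derivative with respect to $y$ in the direction $\nu$. -/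

import Mathlib

open scoped Nat

noncomputable section

namespace Graf

/-- The Euclidean plane `ℝ²`. -/
abbrev Plane : Type := EuclideanSpace ℝ (Fin 2)

/-- Bessel function of the first kind of order `n ≥ 0`, by its everywhere convergent series. -/
def besselJNat (n : ℕ) (z : ℂ) : ℂ :=
  ∑' l : ℕ, (-1 : ℂ) ^ l / ((l ! : ℂ) * ((n + l)! : ℂ)) * (z / 2) ^ (n + 2 * l)

/-- Bessel function of the second kind of order `n ≥ 0` on `ℂ ∖ (-∞, 0]`, by its series with the
principal logarithm and the digamma function `ψ = Γ' / Γ`. -/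
def besselYNat (n : ℕ) (z : ℂ) : ℂ :=
  -(1 / (Real.pi : ℂ)) * (2 / z) ^ n *
      ∑ l ∈ Finset.range n, ((n - 1 - l)! : ℂ) / (l ! : ℂ) * (z / 2) ^ (2 * l)
    + 2 / (Real.pi : ℂ) * Complex.log (z / 2) * besselJNat n z
    - 1 / (Real.pi : ℂ) * (z / 2) ^ n *
      ∑' l : ℕ, (Complex.digamma ((l : ℂ) + 1) + Complex.digamma ((n : ℂ) + (l : ℂ) + 1)) *
        ((-1 : ℂ) ^ l / ((l ! : ℂ) * ((n + l)! : ℂ))) * (z / 2) ^ (2 * l)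

/-- Hankel function of the first kind `H_n = J_n + i Y_n` of order `n ≥ 0`. -/
def hankelNat (n : ℕ) (z : ℂ) : ℂ := besselJNat n z + Complex.I * besselYNat n z

/-- Bessel function of the first kind of integer order, with `J_{-n} = (-1)^n J_n`. -/
def besselJ (m : ℤ) (z : ℂ) : ℂ :=
  if 0 ≤ m then besselJNat m.natAbs z else (-1 : ℂ) ^ m.natAbs * besselJNat m.natAbs z

/-- Hankel function of the first kind of integer order, with `H_{-n} = (-1)^n H_n`. -/
def hankel (m : ℤ) (z : ℂ) : ℂ :=
  if 0 ≤ m then hankelNat m.natAbs z else (-1 : ℂ) ^ m.natAbs * hankelNat m.natAbs z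

/-- The polar angle of a vector of the plane, measured counter-clockwise from `(1, 0)`. -/
def polarAngle (v : Plane) : ℝ := Complex.arg (⟨v 0, v 1⟩ : ℂ)

/-- The Green function `G(v; k) = (i/4) H_0(k |v|)` of the Helmholtz equation. -/
def green (v : Plane) (k : ℂ) : ℂ := Complex.I / 4 * hankel 0 (k * (‖v‖ : ℂ))

/-- The truncation to the orders `|m| ≤ M` of the Graf expansion about `xj` of the field at `x`
of a point source located at `y`. -/
def greenTrunc (xj : Plane) (M : ℕ) (x y : Plane) (k : ℂ) : ℂ :=
  Complex.I / 4 * ∑ m ∈ Finset.Icc (-(M : ℤ)) (M : ℤ),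
    hankel m (k * (‖x - xj‖ : ℂ)) * besselJ m (k * (‖y - xj‖ : ℂ)) *
      Complex.exp (Complex.I * (m : ℂ) *
        ((polarAngle (x - xj) - polarAngle (y - xj) : ℝ) : ℂ))

/-- The monopole truncation error. -/
def monopoleError (xj : Plane) (M : ℕ) (x y : Plane) (k : ℂ) : ℝ :=
  ‖green (x - y) k - greenTrunc xj M x y k‖

/-- The dipole truncation error: modulus of the derivative of the difference at the source point
`y`, in the direction `ν`. -/
def dipoleError (xj : Plane) (M : ℕ) (x y ν : Plane) (k : ℂ) : ℝ :=
  ‖lineDeriv ℝ (fun y' : Plane => green (x - y') k - greenTrunc xj M x y' k) y ν‖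

/-- `max_{y ∈ Y} |y - xj|` (attained for a nonempty compact set `Y`). -/
def maxDist (xj : Plane) (Y : Set Plane) : ℝ := sSup ((fun y : Plane => ‖y - xj‖) '' Y)

/-- The closed disk about `xj` of radius `max_{y ∈ Y} |y - xj|`. -/
def maxDisk (xj : Plane) (Y : Set Plane) : Set Plane := {x | ‖x - xj‖ ≤ maxDist xj Y}

/-- The ratio `a_x = max_{y ∈ Y} |y - xj| / |x - xj|`. -/
def ratio (xj : Plane) (Y : Set Plane) (x : Plane) : ℝ := maxDist xj Y / ‖x - xj‖

end Graf

end

/-! A vector with complex form `ξ` is encoded by the pair `P = kξ/2`, `Q = kξ̄/2`, treated as two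
independent complex variables. With the angular factor absorbed, the Bessel and Hankel functions
become `bess m P Q` and `cyl m P Q L`, where `L` stands for the logarithm. They satisfy `∂/∂P F_m =
F_{m-1}` and `∂/∂Q F_m = -F_{m+1}`, provided `L` varies like half the logarithm of `PQ`
(`hasDerivAt_bess`, `hasDerivAt_cyl`).

Taylor expansion of `cyl n` in `P` and then in `Q` therefore writes `cyl n (P - α) (Q - β)` as a
double series over powers of `α` and `β`. It converges absolutely for `|α| = |β| < |P| = |Q|`. Its
terms with a fixed difference `m` of exponents share the factor `cyl (n + m) P Q L`, and the
remaining sum over them is `bess m β α`: this is Graf's theorem, `hasSum_graf`.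

The errors are tails of such series. The bounds `|cyl m| ≤ C (|m|-1)! |P|^{-|m|}` and `|bess m| ≤ C
|β|^{|m|}/|m|!` give monopole terms of size `a^{|m|}/|m|`, whose tail is logarithmic. A derivative
in `y` moves the order of `bess` by one and costs a factor of order `|m|`, so the dipole tail is
geometric. No infinite series is differentiated in `y`: the derivative of the Green function is a
combination of `cyl (-1)` and `cyl 1`, and Graf's theorem with `n = ±1` expands these directly. -/

open scoped Nat

noncomputable section

namespace Graf

/-! ### Power series dominated by an exponential series. -/

section Entire

variable {c : ℕ → ℂ} {D B : ℝ}

lemma hasSum_exp_majorant (D B : ℝ) (s : ℂ) :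
    HasSum (fun l : ℕ => D * (B ^ l / (l ! : ℝ)) * ‖s‖ ^ l) (D * Real.exp (B * ‖s‖)) := by
  have h := NormedSpace.expSeries_div_hasSum_exp (𝔸 := ℝ) (B * ‖s‖)
  rw [← Real.exp_eq_exp_ℝ] at h
  refine HasSum.congr_fun (h.mul_left D) fun l => Eq.symm ?_
  rw [mul_pow]; ring

lemma norm_term_le (hc : ∀ l, ‖c l‖ ≤ D * (B ^ l / (l ! : ℝ))) (s : ℂ) (l : ℕ) :
    ‖c l * s ^ l‖ ≤ D * (B ^ l / (l ! : ℝ)) * ‖s‖ ^ l := by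
  rw [norm_mul, norm_pow]
  exact mul_le_mul_of_nonneg_right (hc l) (by positivity)

lemma summable_entire (hc : ∀ l, ‖c l‖ ≤ D * (B ^ l / (l ! : ℝ))) (s : ℂ) :
    Summable fun l => c l * s ^ l :=
  .of_norm_bounded (hasSum_exp_majorant D B s).summable (norm_term_le hc s)

lemma norm_entire_le (hc : ∀ l, ‖c l‖ ≤ D * (B ^ l / (l ! : ℝ))) (s : ℂ) :
    ‖∑' l, c l * s ^ l‖ ≤ D * Real.exp (B * ‖s‖) :=
  tsum_of_norm_bounded (hasSum_exp_majorant D B s) (norm_term_le hc s)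

lemma norm_derivCoeff_le (hc : ∀ l, ‖c l‖ ≤ D * (B ^ l / (l ! : ℝ))) (l : ℕ) :
    ‖((l : ℂ) + 1) * c (l + 1)‖ ≤ (D * B) * (B ^ l / (l ! : ℝ)) := by
  have h1 : ‖((l : ℂ) + 1)‖ = (l : ℝ) + 1 := by
    rw [← Nat.cast_add_one, Complex.norm_natCast, Nat.cast_add_one]
  have h2 := hc (l + 1)
  rw [norm_mul, h1]
  refine (mul_le_mul_of_nonneg_left h2 (by positivity)).trans_eq ?_
  rw [Nat.factorial_succ]
  push_cast
  have : (l ! : ℝ) ≠ 0 := by positivity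
  have : (l : ℝ) + 1 ≠ 0 := by positivity
  field_simp
  ring

lemma hasDerivAt_entire (hc : ∀ l, ‖c l‖ ≤ D * (B ^ l / (l ! : ℝ))) (s : ℂ) :
    HasDerivAt (fun z => ∑' l, c l * z ^ l) (∑' l : ℕ, ((l : ℂ) + 1) * c (l + 1) * s ^ l) s := by
  -- A ball strictly larger than `‖s‖` gives one summable majorant for the derived terms on an open
  -- set containing `s`.
  set R : ℝ := ‖s‖ + 1
  have hR : 0 ≤ R := by positivity
  let u : ℕ → ℝ := fun l => ‖c l * l‖ * R ^ (l - 1)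
  have hu : Summable u := by
    rw [← summable_nat_add_iff 1]
    have h0 := (hasSum_exp_majorant (D * B) B (R : ℂ)).summable
    refine .of_nonneg_of_le (fun l => by positivity) (fun l => ?_) h0
    have h1 := norm_derivCoeff_le hc l
    simp only [u, Nat.add_sub_cancel, Complex.norm_real, Real.norm_eq_abs, abs_of_nonneg hR]
    push_cast
    rw [mul_comm (c (l + 1))]
    gcongr
  have key := hasDerivAt_tsum_of_isPreconnected (𝕜 := ℂ) (F := ℂ) (u := u)
    (t := Metric.ball (0 : ℂ) R) (g := fun l z => c l * z ^ l)
    (g' := fun l z => c l * (l * z ^ (l - 1))) (y₀ := 0) (y := s) hu Metric.isOpen_ball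
    (convex_ball _ _).isPreconnected
    (fun l y _ => (hasDerivAt_pow l y).const_mul (c l))
    (fun l y hy => by
      have : ‖y‖ ≤ R := by simpa using (Metric.mem_ball.1 hy).le
      rw [← mul_assoc, norm_mul, norm_pow]
      exact mul_le_mul_of_nonneg_left (pow_le_pow_left₀ (norm_nonneg _) this _) (norm_nonneg _))
    (by simpa using (by positivity : 0 < R)) (summable_entire hc 0) (by simp [R])
  refine key.congr_deriv ?_
  rw [Summable.tsum_eq_zero_add]
  · simp only [Nat.cast_zero, zero_mul, mul_zero, zero_add, Nat.add_sub_cancel]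
    refine tsum_congr fun l => ?_
    push_cast; ring
  · refine .of_norm_bounded hu fun l => ?_
    have : ‖s‖ ≤ R := by simp [R]
    rw [← mul_assoc, norm_mul, norm_pow]
    exact mul_le_mul_of_nonneg_left (pow_le_pow_left₀ (norm_nonneg _) this _) (norm_nonneg _)

lemma hasSum_mul_deriv_entire (hc : ∀ l, ‖c l‖ ≤ D * (B ^ l / (l ! : ℝ))) (s : ℂ) :
    HasSum (fun l : ℕ => (l : ℂ) * c l * s ^ l)
      (s * ∑' l : ℕ, ((l : ℂ) + 1) * c (l + 1) * s ^ l) := by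
  rw [← hasSum_nat_add_iff' 1]
  simp only [Finset.range_one, Finset.sum_singleton, Nat.cast_zero, zero_mul, sub_zero]
  have h := ((summable_entire (norm_derivCoeff_le hc) s).hasSum).mul_left s
  refine HasSum.congr_fun h fun l => Eq.symm ?_
  push_cast; ring

end Entire

/-! ### The entire and polynomial factors of the Bessel functions, and their recurrences. -/

/-- Coefficients of the entire function `Φ_n(s) = ∑ (-s)^l / (l! (n+l)!)`. -/
def phiCoeff (n l : ℕ) : ℂ := (-1 : ℂ) ^ l / ((l ! : ℂ) * ((n + l)! : ℂ))

/-- Coefficients of the entire function in the regular part of `Y_n`. -/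
def psiCoeff (n l : ℕ) : ℂ :=
  (Complex.digamma ((l : ℂ) + 1) + Complex.digamma ((n : ℂ) + (l : ℂ) + 1)) * phiCoeff n l

/-- The entire function with `J_n(z) = (z / 2)^n Φ_n(z² / 4)`. -/
def phi (n : ℕ) (s : ℂ) : ℂ := ∑' l, phiCoeff n l * s ^ l

/-- The entire function in the regular part of `Y_n`. -/
def psi (n : ℕ) (s : ℂ) : ℂ := ∑' l, psiCoeff n l * s ^ l

/-- The polynomial in the singular part of `Y_n`. -/
def sing (n : ℕ) (s : ℂ) : ℂ :=
  ∑ l ∈ Finset.range n, ((n - 1 - l)! : ℂ) / (l ! : ℂ) * s ^ l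

lemma norm_phiCoeff_le (n l : ℕ) :
    ‖phiCoeff n l‖ ≤ 1 / (n ! : ℝ) * (1 ^ l / (l ! : ℝ)) := by
  have h : (n ! : ℝ) ≤ ((n + l)! : ℝ) := by exact_mod_cast Nat.factorial_le (by omega)
  have h1 : (0 : ℝ) < n ! := by positivity
  have h2 : (0 : ℝ) < l ! := by positivity
  simp only [phiCoeff, norm_div, norm_pow, norm_neg, norm_one, one_pow, norm_mul,
    Complex.norm_natCast]
  rw [one_div_mul_one_div, mul_comm]
  gcongr

lemma digamma_succ (n : ℕ) :
    Complex.digamma ((n : ℂ) + 1 + 1) = Complex.digamma ((n : ℂ) + 1) + 1 / ((n : ℂ) + 1) := by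
  rw [Complex.digamma_apply_add_one]
  · simp
  · intro m h
    have : ((n + 1 + m : ℕ) : ℂ) = 0 := by push_cast; rw [h]; ring
    exact absurd (Nat.cast_eq_zero.1 this) (by omega)

/-- A constant with `|ψ(l + 1)| ≤ digammaConst * 2 ^ l`. -/
def digammaConst : ℝ := ‖Complex.digamma 1‖ + 1

lemma digammaConst_pos : 0 < digammaConst := by unfold digammaConst; positivity

/-- Digamma at the integers grows only logarithmically, but exponential growth is harmless against
the factorials in `psiCoeff`, and it follows at once from the recurrence. -/
lemma norm_digamma_le (l : ℕ) : ‖Complex.digamma ((l : ℂ) + 1)‖ ≤ digammaConst * 2 ^ l := by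
  induction l with
  | zero => simp [digammaConst]
  | succ l ih =>
    push_cast
    rw [digamma_succ]
    have h1 : ‖(1 : ℂ) / ((l : ℂ) + 1)‖ ≤ 1 := by
      rw [← Nat.cast_add_one, norm_div, norm_one, Complex.norm_natCast]
      rw [div_le_one (by positivity)]
      exact_mod_cast Nat.succ_le_succ (Nat.zero_le l)
    have h2 : 1 ≤ digammaConst * 2 ^ l := by
      have : (1 : ℝ) ≤ 2 ^ l := one_le_pow₀ (by norm_num)
      have : 1 ≤ digammaConst := by simp [digammaConst]
      nlinarith
    calc _ ≤ _ := norm_add_le _ _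
      _ ≤ digammaConst * 2 ^ l + digammaConst * 2 ^ l := by linarith
      _ = _ := by ring

lemma norm_psiCoeff_le (n l : ℕ) :
    ‖psiCoeff n l‖ ≤ 2 * digammaConst * 2 ^ n / (n ! : ℝ) * (2 ^ l / (l ! : ℝ)) := by
  have h1 := norm_digamma_le l
  have h2 := norm_digamma_le (n + l)
  push_cast at h2
  have hD := digammaConst_pos
  have h3 : digammaConst * 2 ^ l ≤ digammaConst * 2 ^ (n + l) := by
    gcongr
    · norm_num
    · omega
  have h4 := (norm_add_le (Complex.digamma ((l : ℂ) + 1))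
    (Complex.digamma ((n : ℂ) + (l : ℂ) + 1)))
  rw [psiCoeff, norm_mul]
  calc _ ≤ (2 * (digammaConst * 2 ^ (n + l))) * (1 / (n ! : ℝ) * (1 ^ l / (l ! : ℝ))) :=
        mul_le_mul (by linarith) (norm_phiCoeff_le n l) (norm_nonneg _) (by positivity)
    _ = _ := by rw [pow_add, one_pow]; ring

lemma phiCoeff_succ_right (n l : ℕ) : ((l : ℂ) + 1) * phiCoeff n (l + 1) = -phiCoeff (n + 1) l := by
  have h1 : (l ! : ℂ) ≠ 0 := by exact_mod_cast l.factorial_ne_zero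
  have h2 : (l : ℂ) + 1 ≠ 0 := by exact_mod_cast l.succ_ne_zero
  have h3 : ((n + 1 + l)! : ℂ) ≠ 0 := by exact_mod_cast (n + 1 + l).factorial_ne_zero
  simp only [phiCoeff]
  rw [show n + (l + 1) = n + 1 + l by ring, Nat.factorial_succ]
  push_cast
  field_simp
  ring

lemma phiCoeff_succ_left (n l : ℕ) : ((n : ℂ) + 1 + l) * phiCoeff (n + 1) l = phiCoeff n l := by
  have h1 : (l ! : ℂ) ≠ 0 := by exact_mod_cast l.factorial_ne_zero
  have h2 : (n : ℂ) + l + 1 ≠ 0 := by exact_mod_cast (n + l).succ_ne_zero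
  have h3 : ((n + l)! : ℂ) ≠ 0 := by exact_mod_cast (n + l).factorial_ne_zero
  simp only [phiCoeff]
  rw [show n + 1 + l = (n + l) + 1 by ring, Nat.factorial_succ]
  push_cast
  field_simp
  ring

lemma hasDerivAt_phi (n : ℕ) (s : ℂ) : HasDerivAt (phi n) (-phi (n + 1) s) s := by
  refine (hasDerivAt_entire (norm_phiCoeff_le n) s).congr_deriv ?_
  simp only [phiCoeff_succ_right, neg_mul, tsum_neg, phi]

/-- Coefficientwise this is `(n + 1 + l)/(n + 1 + l)! = 1/(n + l)!`; the second term on the left is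
`s` times the derivative of `phi (n + 1)`. -/
lemma phi_recurrence (n : ℕ) (s : ℂ) :
    ((n : ℂ) + 1) * phi (n + 1) s - s * phi (n + 2) s = phi n s := by
  have h1 := ((summable_entire (norm_phiCoeff_le (n + 1)) s).hasSum).mul_left ((n : ℂ) + 1)
  have h2 := hasSum_mul_deriv_entire (norm_phiCoeff_le (n + 1)) s
  simp only [phiCoeff_succ_right, neg_mul, tsum_neg] at h2
  have h3 := h1.add h2
  have h4 := (summable_entire (norm_phiCoeff_le n) s).hasSum
  have h5 := h3.unique (by
    refine HasSum.congr_fun h4 fun l => Eq.symm ?_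
    rw [← phiCoeff_succ_left n l]; ring)
  simp only [phi]
  rw [← h5]; ring

/-- The derivative of `psi`. -/
def psiDeriv (n : ℕ) (s : ℂ) : ℂ := ∑' l : ℕ, ((l : ℂ) + 1) * psiCoeff n (l + 1) * s ^ l

lemma hasDerivAt_psi (n : ℕ) (s : ℂ) : HasDerivAt (psi n) (psiDeriv n s) s :=
  hasDerivAt_entire (norm_psiCoeff_le n) s

/-- Raising `l` raises both digamma arguments, whereas raising `n` raises only the second. The
discrepancy `1/(l + 1)` reproduces the coefficients of `phi n` except the constant one, hence the
term `1/n!`. -/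
lemma mul_psiDeriv (n : ℕ) (s : ℂ) :
    s * psiDeriv n s = -(s * psi (n + 1) s) + phi n s - 1 / (n ! : ℂ) := by
  have h1 := (summable_entire (norm_derivCoeff_le (norm_psiCoeff_le n)) s).hasSum.mul_left s
  have h2 := (summable_entire (norm_psiCoeff_le (n + 1)) s).hasSum.mul_left s
  have h3 := (hasSum_nat_add_iff' 1).2 (summable_entire (norm_phiCoeff_le n) s).hasSum
  have h4 := h2.neg.add h3
  have h5 := h1.unique (by
    refine HasSum.congr_fun h4 fun l => ?_
    have hd1 := digamma_succ l
    have hd2 := digamma_succ (n + l)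
    have e1 := phiCoeff_succ_right n l
    have hl : (l : ℂ) + 1 ≠ 0 := by exact_mod_cast l.succ_ne_zero
    have hn : (n : ℂ) + l + 1 ≠ 0 := by exact_mod_cast (n + l).succ_ne_zero
    have e2 : phiCoeff n (l + 1) = -phiCoeff (n + 1) l / ((l : ℂ) + 1) := by
      rw [← e1]; field_simp
    simp only [psiCoeff]
    push_cast at hd2 ⊢
    rw [hd1, show (n : ℂ) + ((l : ℂ) + 1) + 1 = n + l + 1 + 1 by ring,
      show (n : ℂ) + 1 + (l : ℂ) + 1 = n + l + 1 + 1 by ring, hd2, e2]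
    field_simp
    ring)
  simp only [psiDeriv, psi, phi]
  rw [h5]
  simp [phiCoeff]
  ring

lemma psi_recurrence (n : ℕ) (s : ℂ) :
    ((n : ℂ) + 1) * psi (n + 1) s + s * psiDeriv (n + 1) s = psi n s + phi (n + 1) s := by
  have h1 := ((summable_entire (norm_psiCoeff_le (n + 1)) s).hasSum).mul_left ((n : ℂ) + 1)
  have h2 := hasSum_mul_deriv_entire (norm_psiCoeff_le (n + 1)) s
  have h3 := (summable_entire (norm_psiCoeff_le n) s).hasSum
  have h4 := (summable_entire (norm_phiCoeff_le (n + 1)) s).hasSum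
  refine (h1.add h2).unique ?_
  refine HasSum.congr_fun (h3.add h4) fun l => ?_
  have hd2 := digamma_succ (n + l)
  have hn : (n : ℂ) + l + 1 ≠ 0 := by exact_mod_cast (n + l).succ_ne_zero
  simp only [psiCoeff]
  rw [← phiCoeff_succ_left n l]
  push_cast at hd2 ⊢
  rw [show (n : ℂ) + 1 + (l : ℂ) + 1 = n + l + 1 + 1 by ring, hd2]
  field_simp
  ring

lemma hasDerivAt_sing_succ (n : ℕ) (s : ℂ) : HasDerivAt (sing (n + 1)) (sing n s) s := by
  have h : HasDerivAt (sing (n + 1)) (∑ l ∈ Finset.range (n + 1),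
      ((n + 1 - 1 - l)! : ℂ) / (l ! : ℂ) * (l * s ^ (l - 1))) s := by
    unfold sing
    exact HasDerivAt.fun_sum fun l _ => (hasDerivAt_pow l s).const_mul _
  refine h.congr_deriv ?_
  rw [Finset.sum_range_succ']
  simp only [sing, Nat.cast_zero, zero_mul, mul_zero, add_zero]
  refine Finset.sum_congr rfl fun l _ => ?_
  have h1 : (l ! : ℂ) ≠ 0 := by exact_mod_cast l.factorial_ne_zero
  have h2 : (l : ℂ) + 1 ≠ 0 := by exact_mod_cast l.succ_ne_zero
  rw [show n + 1 - 1 - (l + 1) = n - 1 - l by omega, Nat.factorial_succ, Nat.add_sub_cancel]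
  push_cast
  field_simp

/-- The subtracted power is the top term of `sing (n + 2)`. It later cancels the term `1/(n + 1)!`
of `mul_psiDeriv`. -/
lemma sing_recurrence (n : ℕ) (s : ℂ) :
    ((n : ℂ) + 1) * sing (n + 1) s - s * sing n s = sing (n + 2) s - s ^ (n + 1) / ((n + 1)! : ℂ) := by
  have h0 : sing (n + 2) s - s ^ (n + 1) / ((n + 1)! : ℂ) =
      ∑ l ∈ Finset.range (n + 1), ((n + 1 - l)! : ℂ) / (l ! : ℂ) * s ^ l := by
    rw [sing, Finset.sum_range_succ, show n + 2 - 1 - (n + 1) = 0 by omega]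
    simp
    ring
  have h1 : s * sing n s = ∑ l ∈ Finset.range (n + 1),
      ((n - l)! : ℂ) / (l ! : ℂ) * l * s ^ l := by
    rw [Finset.sum_range_succ']
    simp only [Nat.cast_zero, mul_zero, zero_mul, add_zero, sing, Finset.mul_sum]
    refine Finset.sum_congr rfl fun l _ => ?_
    have h1 : (l ! : ℂ) ≠ 0 := by exact_mod_cast l.factorial_ne_zero
    have h2 : (l : ℂ) + 1 ≠ 0 := by exact_mod_cast l.succ_ne_zero
    rw [show n - (l + 1) = n - 1 - l by omega, Nat.factorial_succ]
    push_cast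
    field_simp
    ring
  rw [h0, h1, sing, Finset.mul_sum, ← Finset.sum_sub_distrib]
  refine Finset.sum_congr rfl fun l hl => ?_
  have hl' : l ≤ n := by simpa [Nat.lt_succ_iff] using hl
  rw [show n + 1 - 1 - l = n - l by omega, show n + 1 - l = (n - l) + 1 by omega,
    Nat.factorial_succ]
  push_cast [Nat.cast_sub hl']
  ring

/-! ### Extension of derivative rules to integer orders. -/

/-- Extension of a family `F n P Q`, `n ≥ 0`, to integer orders by
`F_{-n}(P, Q) = (-1)^n F_n(Q, P)`. -/
def intExt (F : ℕ → ℂ → ℂ → ℂ) (m : ℤ) (P Q : ℂ) : ℂ :=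
  if 0 ≤ m then F m.natAbs P Q else (-1 : ℂ) ^ m.natAbs * F m.natAbs Q P

section IntExt

variable {F G : ℕ → ℂ → ℂ → ℂ}

lemma intExt_natCast (n : ℕ) (P Q : ℂ) : intExt F n P Q = F n P Q := by simp [intExt]

lemma intExt_neg_natCast (hF : ∀ a b, F 0 a b = F 0 b a) (n : ℕ) (P Q : ℂ) :
    intExt F (-n) P Q = (-1 : ℂ) ^ n * F n Q P := by
  rcases n with _ | n
  · simp [intExt, hF P Q]
  · have : ¬ (0 : ℤ) ≤ -((n + 1 : ℕ) : ℤ) := by push_cast; omega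
    rw [intExt, if_neg this]
    simp only [Int.natAbs_neg, Int.natAbs_natCast]

/-- Reflecting the order swaps `P` and `Q`, so the rule at negative orders is the rule at positive
orders with the variables exchanged. The term in `c` carries the inhomogeneity that a logarithm must
compensate. -/
lemma hasDerivAt_intExt (hF : ∀ a b, F 0 a b = F 0 b a) {P Q : ℂ → ℂ} {t P' Q' c : ℂ}
    (h0 : HasDerivAt (fun z => F 0 (P z) (Q z))
      (-P' * F 1 (Q t) (P t) - Q' * F 1 (P t) (Q t) + c * G 0 (P t) (Q t)) t)
    (h1 : ∀ n, HasDerivAt (fun z => F (n + 1) (P z) (Q z))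
      (P' * F n (P t) (Q t) - Q' * F (n + 2) (P t) (Q t) + c * G (n + 1) (P t) (Q t)) t)
    (h2 : ∀ n, HasDerivAt (fun z => F (n + 1) (Q z) (P z))
      (Q' * F n (Q t) (P t) - P' * F (n + 2) (Q t) (P t) + c * G (n + 1) (Q t) (P t)) t)
    (m : ℤ) :
    HasDerivAt (fun z => intExt F m (P z) (Q z))
      (P' * intExt F (m - 1) (P t) (Q t) - Q' * intExt F (m + 1) (P t) (Q t)
        + c * intExt G m (P t) (Q t)) t := by
  have hneg : ∀ (H : ℕ → ℂ → ℂ → ℂ) (n : ℕ) (a b : ℂ), intExt H (-((n + 1 : ℕ) : ℤ)) a b =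
      (-1 : ℂ) ^ (n + 1) * H (n + 1) b a := fun H n a b => by
    rw [intExt, if_neg (by push_cast; omega)]
    simp only [Int.natAbs_neg, Int.natAbs_natCast]
  obtain ⟨n, rfl | rfl⟩ := m.eq_nat_or_neg
  · rcases n with _ | n
    · have e1 := hneg F 0 (P t) (Q t)
      have e2 := intExt_natCast (F := F) 1 (P t) (Q t)
      simp only [intExt_natCast]
      refine h0.congr_deriv ?_
      simp only [zero_add, Nat.cast_one, Nat.cast_zero] at e1 e2 ⊢
      simp only [zero_sub, e1, e2]
      ring
    · simp only [intExt_natCast]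
      refine (h1 n).congr_deriv ?_
      rw [show ((n + 1 : ℕ) : ℤ) - 1 = (n : ℤ) by push_cast; ring,
        show ((n + 1 : ℕ) : ℤ) + 1 = ((n + 2 : ℕ) : ℤ) by push_cast; ring]
      simp only [intExt_natCast]
  · rcases n with _ | n
    · have e1 := hneg F 0 (P t) (Q t)
      have e2 := intExt_natCast (F := F) 1 (P t) (Q t)
      have e3 := intExt_natCast (F := G) 0 (P t) (Q t)
      have e4 : ∀ z, intExt F (-((0 : ℕ) : ℤ)) (P z) (Q z) = F 0 (P z) (Q z) := fun z => by
        simp [intExt]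
      simp only [e4]
      refine h0.congr_deriv ?_
      simp only [zero_add, Nat.cast_one, Nat.cast_zero, neg_zero] at e1 e2 e3 ⊢
      simp only [zero_sub, e1, e2, e3]
      ring
    · simp only [hneg]
      refine ((h2 n).const_mul _).congr_deriv ?_
      rw [show -((n + 1 : ℕ) : ℤ) - 1 = -((n + 1 + 1 : ℕ) : ℤ) by push_cast; ring,
        show -((n + 1 : ℕ) : ℤ) + 1 = -(n : ℤ) by push_cast; ring,
        hneg, intExt_neg_natCast hF]
      ring

end IntExt

/-! ### Cylinder functions in the variables `P`, `Q` and their ladder relations. -/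

/-- `J_n(2√(PQ)) (P/Q)^{n/2}` for `n ≥ 0`. -/
def besselPart (n : ℕ) (P Q : ℂ) : ℂ := P ^ n * phi n (P * Q)

/-- The part of `-π Y_n(2√(PQ)) (P/Q)^{n/2}`, `n ≥ 0`, without logarithm. -/
def neumannPart (n : ℕ) (P Q : ℂ) : ℂ := Q⁻¹ ^ n * sing n (P * Q) + P ^ n * psi n (P * Q)

/-- `J_m(2√(PQ)) (P/Q)^{m/2}`, as an entire function of `P` and `Q`. -/
def bess (m : ℤ) (P Q : ℂ) : ℂ := intExt besselPart m P Q

/-- `H_m(2√(PQ)) (P/Q)^{m/2}`, where `L` stands for the logarithm of `√(PQ)`. -/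
def cyl (m : ℤ) (P Q L : ℂ) : ℂ :=
  (1 + 2 * Complex.I / (Real.pi : ℂ) * L) * bess m P Q
    - Complex.I / (Real.pi : ℂ) * intExt neumannPart m P Q

lemma besselPart_zero_symm (a b : ℂ) : besselPart 0 a b = besselPart 0 b a := by
  simp [besselPart, mul_comm]

lemma neumannPart_zero_symm (a b : ℂ) : neumannPart 0 a b = neumannPart 0 b a := by
  simp [neumannPart, mul_comm]

section Deriv

variable {P Q L : ℂ → ℂ} {t P' Q' : ℂ}

lemma hasDerivAt_besselPart_succ (hP : HasDerivAt P P' t) (hQ : HasDerivAt Q Q' t) (n : ℕ) :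
    HasDerivAt (fun z => besselPart (n + 1) (P z) (Q z))
      (P' * besselPart n (P t) (Q t) - Q' * besselPart (n + 2) (P t) (Q t)) t := by
  have h := (hP.fun_pow (n + 1)).mul ((hasDerivAt_phi (n + 1) (P t * Q t)).comp t (hP.mul hQ))
  refine h.congr_deriv ?_
  have := phi_recurrence n (P t * Q t)
  simp only [besselPart, Nat.add_sub_cancel, Function.comp, Pi.mul_apply]
  push_cast
  linear_combination (P t ^ n * P') * this

lemma hasDerivAt_bess (hP : HasDerivAt P P' t) (hQ : HasDerivAt Q Q' t) (m : ℤ) :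
    HasDerivAt (fun z => bess m (P z) (Q z))
      (P' * bess (m - 1) (P t) (Q t) - Q' * bess (m + 1) (P t) (Q t)) t := by
  have key := hasDerivAt_intExt (F := besselPart) (G := besselPart) (P := P) (Q := Q) (P' := P')
    (Q' := Q') (t := t) (c := 0) besselPart_zero_symm
    (by
      have h := (hasDerivAt_phi 0 (P t * Q t)).comp t (hP.mul hQ)
      simp only [besselPart, pow_zero, one_mul]
      refine h.congr_deriv ?_
      rw [mul_comm (Q t) (P t)]
      ring)
    (fun n => (hasDerivAt_besselPart_succ hP hQ n).congr_deriv (by ring))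
    (fun n => (hasDerivAt_besselPart_succ hQ hP n).congr_deriv (by ring)) m
  exact key.congr_deriv (by simp [bess])

lemma hasDerivAt_neumannPart_succ (hP : HasDerivAt P P' t) (hQ : HasDerivAt Q Q' t)
    (hP0 : P t ≠ 0) (hQ0 : Q t ≠ 0) (n : ℕ) :
    HasDerivAt (fun z => neumannPart (n + 1) (P z) (Q z))
      (P' * neumannPart n (P t) (Q t) - Q' * neumannPart (n + 2) (P t) (Q t)
        + (P' / P t + Q' / Q t) * besselPart (n + 1) (P t) (Q t)) t := by
  have h1 := (hP.fun_pow (n + 1)).mul ((hasDerivAt_psi (n + 1) (P t * Q t)).comp t (hP.mul hQ))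
  have h2 := ((hQ.fun_inv hQ0).fun_pow (n + 1)).mul
    ((hasDerivAt_sing_succ n (P t * Q t)).comp t (hP.mul hQ))
  refine (h2.add h1).congr_deriv ?_
  have e1 := mul_psiDeriv (n + 1) (P t * Q t)
  have e2 := psi_recurrence n (P t * Q t)
  have e3 := sing_recurrence n (P t * Q t)
  simp only [besselPart, neumannPart, Nat.add_sub_cancel, Function.comp, Pi.mul_apply]
  generalize P t = p at *
  generalize Q t = q at *
  have hq : q * q⁻¹ = 1 := mul_inv_cancel₀ hQ0
  have hp : p * p⁻¹ = 1 := mul_inv_cancel₀ hP0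
  -- This identity cancels the leftover power in `e3` against the constant in `e1`.
  have e4 : (p * q) ^ (n + 1) * q⁻¹ ^ (n + 1) = p ^ (n + 1) := by
    rw [← mul_pow, mul_assoc, hq, mul_one]
  simp only [div_eq_mul_inv, ← inv_pow] at *
  push_cast at *
  generalize q⁻¹ = w at *
  generalize p⁻¹ = u at *
  linear_combination (P' * p ^ n) * e2 - (P' * p ^ n * phi (n + 1) (p * q)) * hp
    + (w ^ n * P' * sing n (p * q)) * hq - (Q' * w ^ (n + 2)) * e3
    - (Q' * p * w ^ (n + 1) * sing n (p * q)) * hq + (Q' * p ^ (n + 1) * w) * e1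
    - (Q' * p ^ (n + 2) * (psiDeriv (n + 1) (p * q) + psi (n + 2) (p * q))) * hq
    + (Q' * w * ((n + 1)! : ℂ)⁻¹) * e4

lemma hasDerivAt_intExt_neumannPart (hP : HasDerivAt P P' t) (hQ : HasDerivAt Q Q' t)
    (hP0 : P t ≠ 0) (hQ0 : Q t ≠ 0) (m : ℤ) :
    HasDerivAt (fun z => intExt neumannPart m (P z) (Q z))
      (P' * intExt neumannPart (m - 1) (P t) (Q t) - Q' * intExt neumannPart (m + 1) (P t) (Q t)
        + (P' / P t + Q' / Q t) * bess m (P t) (Q t)) t := by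
  refine hasDerivAt_intExt neumannPart_zero_symm ?_
    (hasDerivAt_neumannPart_succ hP hQ hP0 hQ0)
    (fun n => (hasDerivAt_neumannPart_succ hQ hP hQ0 hP0 n).congr_deriv (by ring)) m
  have h := (hasDerivAt_psi 0 (P t * Q t)).comp t (hP.mul hQ)
  have e0 : ∀ z, neumannPart 0 (P z) (Q z) = psi 0 (P z * Q z) := fun z => by
    simp [neumannPart, sing]
  have e1 := mul_psiDeriv 0 (P t * Q t)
  have e2 : ∀ s, sing 1 s = 1 := fun s => by simp [sing]
  simp only [e0]
  refine h.congr_deriv ?_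
  simp only [neumannPart, besselPart, e2, mul_comm (Q t) (P t)]
  simp at e1 ⊢
  field_simp
  linear_combination (P' * Q t + P t * Q') * e1

/-- The derivative of `L` times `bess` cancels the inhomogeneous term of the Neumann part exactly.
Only the derivative of `L` matters, so no branch has to be chosen. -/
lemma hasDerivAt_cyl (hP : HasDerivAt P P' t) (hQ : HasDerivAt Q Q' t)
    (hL : HasDerivAt L ((P' / P t + Q' / Q t) / 2) t) (hP0 : P t ≠ 0) (hQ0 : Q t ≠ 0) (m : ℤ) :
    HasDerivAt (fun z => cyl m (P z) (Q z) (L z))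
      (P' * cyl (m - 1) (P t) (Q t) (L t) - Q' * cyl (m + 1) (P t) (Q t) (L t)) t := by
  have h := (((hL.const_mul (2 * Complex.I / (Real.pi : ℂ))).const_add 1).mul
    (hasDerivAt_bess hP hQ m)).sub
    ((hasDerivAt_intExt_neumannPart hP hQ hP0 hQ0 m).const_mul (Complex.I / (Real.pi : ℂ)))
  refine h.congr_deriv ?_
  simp only [cyl]
  ring

end Deriv

/-! ### Taylor expansion in each variable separately. -/

lemma hasSum_taylor_of_hasDerivAt_succ {F : ℕ → ℂ → ℂ} {r : ℝ}
    (h : ∀ a, ∀ z ∈ Metric.ball (0 : ℂ) r, HasDerivAt (F a) (F (a + 1) z) z) {z : ℂ}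
    (hz : z ∈ Metric.ball (0 : ℂ) r) :
    HasSum (fun a : ℕ => z ^ a / (a ! : ℂ) * F a 0) (F 0 z) := by
  have hiter : ∀ (a : ℕ), ∀ w ∈ Metric.ball (0 : ℂ) r, iteratedDeriv a (F 0) w = F a w := by
    intro a
    induction a with
    | zero => simp
    | succ a ih =>
      intro w hw
      rw [iteratedDeriv_succ]
      have : iteratedDeriv a (F 0) =ᶠ[nhds w] F a :=
        Filter.eventually_of_mem (Metric.isOpen_ball.mem_nhds hw) ih
      rw [this.deriv_eq, (h a w hw).deriv]
  have h0 : (0 : ℂ) ∈ Metric.ball (0 : ℂ) r := Metric.mem_ball_self (Metric.pos_of_mem_ball hz)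
  have key := Complex.hasSum_taylorSeries_on_ball (f := F 0) (c := 0) (r := r)
    (fun w hw => (h 0 w hw).differentiableAt.differentiableWithinAt) hz
  refine key.congr_fun fun a => ?_
  rw [hiter a 0 h0, sub_zero, smul_eq_mul, smul_eq_mul]
  ring

lemma one_sub_div_mem_slitPlane {z P : ℂ} (h : ‖z‖ < ‖P‖) : 1 - z / P ∈ Complex.slitPlane := by
  left
  have h1 : ‖z / P‖ < 1 := by rw [norm_div]; exact (div_lt_one ((norm_nonneg z).trans_lt h)).2 h
  have := (Complex.re_le_norm (z / P)).trans_lt h1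
  simpa using this

lemma hasDerivAt_log_shift {z P : ℂ} (h : ‖z‖ < ‖P‖) (L : ℂ) :
    HasDerivAt (fun w => L + Complex.log (1 - w / P) / 2) (-1 / (P - z) / 2) z := by
  have hP : P ≠ 0 := norm_pos_iff.1 ((norm_nonneg z).trans_lt h)
  have hm := one_sub_div_mem_slitPlane h
  have h1 := ((((hasDerivAt_id z).div_const P).const_sub 1).clog hm).div_const 2 |>.const_add L
  refine h1.congr_deriv ?_
  have h2 : P - z ≠ 0 := fun h' => by rw [sub_eq_zero.1 h'] at h; exact lt_irrefl _ h
  have h3 : 1 - z / P ≠ 0 := Complex.slitPlane_ne_zero hm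
  have h4 : P * (1 - z / P) = P - z := by field_simp
  simp only [id]
  rw [← h4]
  field_simp

lemma hasSum_cyl_sub_left {P Q z : ℂ} (hQ : Q ≠ 0) (hz : ‖z‖ < ‖P‖) (L : ℂ) (m : ℤ) :
    HasSum (fun a : ℕ => (-z) ^ a / (a ! : ℂ) * cyl (m - a) P Q L)
      (cyl m (P - z) Q (L + Complex.log (1 - z / P) / 2)) := by
  have key := hasSum_taylor_of_hasDerivAt_succ (r := ‖P‖) (z := z)
    (F := fun a w => (-1) ^ a * cyl (m - a) (P - w) Q (L + Complex.log (1 - w / P) / 2))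
    (fun a w hw => by
      have hw : ‖w‖ < ‖P‖ := by simpa using hw
      have h2 : P - w ≠ 0 := fun h' => by rw [sub_eq_zero.1 h'] at hw; exact lt_irrefl _ hw
      have h := hasDerivAt_cyl ((hasDerivAt_id w).const_sub P) (hasDerivAt_const w Q)
        ((hasDerivAt_log_shift hw L).congr_deriv (by simp)) h2 hQ (m - a)
      refine (h.const_mul ((-1) ^ a)).congr_deriv ?_
      rw [show m - ((a + 1 : ℕ) : ℤ) = m - a - 1 by push_cast; ring]
      simp only [id]
      ring)
    (by simpa using hz)
  simp only [pow_zero, one_mul, Nat.cast_zero, sub_zero, zero_div, Complex.log_one, add_zero]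
    at key
  refine key.congr_fun fun a => ?_
  rw [neg_pow]; ring

lemma hasSum_cyl_sub_right {P Q z : ℂ} (hP : P ≠ 0) (hz : ‖z‖ < ‖Q‖) (L : ℂ) (m : ℤ) :
    HasSum (fun b : ℕ => z ^ b / (b ! : ℂ) * cyl (m + b) P Q L)
      (cyl m P (Q - z) (L + Complex.log (1 - z / Q) / 2)) := by
  have key := hasSum_taylor_of_hasDerivAt_succ (r := ‖Q‖) (z := z)
    (F := fun a w => cyl (m + a) P (Q - w) (L + Complex.log (1 - w / Q) / 2))
    (fun a w hw => by
      have hw : ‖w‖ < ‖Q‖ := by simpa using hw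
      have h2 : Q - w ≠ 0 := fun h' => by rw [sub_eq_zero.1 h'] at hw; exact lt_irrefl _ hw
      have h := hasDerivAt_cyl (hasDerivAt_const w P) ((hasDerivAt_id w).const_sub Q)
        ((hasDerivAt_log_shift hw L).congr_deriv (by simp)) hP h2 (m + a)
      refine h.congr_deriv ?_
      rw [show m + ((a + 1 : ℕ) : ℤ) = m + a + 1 by push_cast; ring]
      simp only [id]
      ring)
    (by simpa using hz)
  simpa only [Nat.cast_zero, sub_zero, zero_div, Complex.log_one, add_zero] using key

/-! ### Bounds uniform in the order. -/

section Bounds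

variable {P Q L : ℂ} {w W Λ : ℝ}

lemma norm_intExt_le {F : ℕ → ℂ → ℂ → ℂ} {m : ℤ} {B : ℝ} (h1 : ‖F m.natAbs P Q‖ ≤ B)
    (h2 : ‖F m.natAbs Q P‖ ≤ B) : ‖intExt F m P Q‖ ≤ B := by
  unfold intExt
  split_ifs
  · exact h1
  · simpa using h2

lemma norm_besselPart_le (hP : ‖P‖ = w) (hQ : ‖Q‖ = w) (n : ℕ) :
    ‖besselPart n P Q‖ ≤ w ^ n / (n ! : ℝ) * Real.exp (w ^ 2) := by
  have h := norm_entire_le (norm_phiCoeff_le n) (P * Q)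
  have hw : 0 ≤ w := hP ▸ norm_nonneg P
  rw [norm_mul, hP, hQ] at h
  rw [besselPart, norm_mul, norm_pow, hP]
  refine (mul_le_mul_of_nonneg_left h (by positivity)).trans_eq ?_
  rw [one_mul, sq]; ring

lemma norm_bess_le (hP : ‖P‖ = w) (hQ : ‖Q‖ = w) (m : ℤ) :
    ‖bess m P Q‖ ≤ w ^ m.natAbs / (m.natAbs ! : ℝ) * Real.exp (w ^ 2) :=
  norm_intExt_le (norm_besselPart_le hP hQ _) (norm_besselPart_le hQ hP _)

/-- Puts the regular parts, of size `w^n/n!` or `(2w)^n/n!`, under the same growth `(n - 1)! w^{-n}`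
as the singular part. Truncated subtraction makes the factorial `1` at `n = 0`. -/
lemma pow_div_factorial_le {x : ℝ} (hw : 0 < w) (hx : 0 ≤ x) (n : ℕ) :
    (x / w) ^ n / (n ! : ℝ) ≤ ((n - 1)! : ℝ) * w⁻¹ ^ n * Real.exp x := by
  have h1 := Real.pow_div_factorial_le_exp x hx n
  have h2 : (1 : ℝ) ≤ ((n - 1)! : ℝ) := by
    exact_mod_cast Nat.one_le_iff_ne_zero.2 (Nat.factorial_ne_zero _)
  calc (x / w) ^ n / (n ! : ℝ) = 1 * w⁻¹ ^ n * (x ^ n / (n ! : ℝ)) := by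
        rw [div_pow, inv_pow]; ring
    _ ≤ _ := by gcongr

lemma norm_sing_le {s : ℂ} (n : ℕ) : ‖sing n s‖ ≤ ((n - 1)! : ℝ) * Real.exp ‖s‖ := by
  refine (norm_sum_le _ _).trans ?_
  calc _ ≤ ∑ l ∈ Finset.range n, ((n - 1)! : ℝ) * (‖s‖ ^ l / (l ! : ℝ)) := by
        refine Finset.sum_le_sum fun l _ => ?_
        have : ((n - 1 - l)! : ℝ) ≤ ((n - 1)! : ℝ) := by
          exact_mod_cast Nat.factorial_le (by omega)
        rw [norm_mul, norm_div, norm_pow, Complex.norm_natCast, Complex.norm_natCast,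
          div_mul_eq_mul_div, mul_div_assoc]
        gcongr
    _ ≤ _ := by
        rw [← Finset.mul_sum]
        gcongr
        exact Real.sum_le_exp_of_nonneg (norm_nonneg s) n

lemma norm_neumannPart_le (hP : ‖P‖ = w) (hQ : ‖Q‖ = w) (hw : 0 < w) (n : ℕ) :
    ‖neumannPart n P Q‖ ≤ ((n - 1)! : ℝ) * w⁻¹ ^ n *
      (Real.exp (w ^ 2) + 2 * digammaConst * Real.exp (4 * w ^ 2)) := by
  have h1 := norm_sing_le (s := P * Q) n
  have h2 := norm_entire_le (norm_psiCoeff_le n) (P * Q)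
  have h3 := pow_div_factorial_le hw (by positivity : 0 ≤ 2 * w ^ 2) n
  have hD := digammaConst_pos
  rw [norm_mul, hP, hQ, ← sq] at h1 h2
  refine (norm_add_le _ _).trans ?_
  rw [norm_mul, norm_mul, norm_pow, norm_pow, norm_inv, hP, hQ, mul_add]
  refine add_le_add ?_ ?_
  · refine (mul_le_mul_of_nonneg_left h1 (by positivity)).trans_eq (by ring)
  · refine (mul_le_mul_of_nonneg_left h2 (by positivity)).trans ?_
    calc _ = 2 * digammaConst * Real.exp (2 * w ^ 2) * ((2 * w ^ 2 / w) ^ n / (n ! : ℝ)) := by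
          rw [show 2 * w ^ 2 / w = 2 * w by field_simp, mul_pow]; ring
      _ ≤ 2 * digammaConst * Real.exp (2 * w ^ 2) *
          (((n - 1)! : ℝ) * w⁻¹ ^ n * Real.exp (2 * w ^ 2)) := by gcongr
      _ = _ := by
          rw [show 4 * w ^ 2 = 2 * w ^ 2 + 2 * w ^ 2 by ring, Real.exp_add]; ring

/-- The constant in the bound for cylinder functions of large order. -/
def cylConst (W Λ : ℝ) : ℝ :=
  (1 + 2 / Real.pi * Λ) * Real.exp (2 * W ^ 2)
    + 1 / Real.pi * (Real.exp (W ^ 2) + 2 * digammaConst * Real.exp (4 * W ^ 2))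

lemma cylConst_pos (hΛ : 0 ≤ Λ) : 0 < cylConst W Λ := by
  have := digammaConst_pos
  have := Real.pi_pos
  unfold cylConst; positivity

lemma norm_cyl_le (hP : ‖P‖ = w) (hQ : ‖Q‖ = w) (hw : 0 < w) (hW : w ≤ W) (hL : ‖L‖ ≤ Λ)
    (m : ℤ) :
    ‖cyl m P Q L‖ ≤ cylConst W Λ * (((m.natAbs - 1)! : ℝ) * w⁻¹ ^ m.natAbs) := by
  have hD := digammaConst_pos
  have hpi := Real.pi_pos
  have hΛ : 0 ≤ Λ := (norm_nonneg L).trans hL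
  have h0 := norm_bess_le hP hQ m
  have h1 := pow_div_factorial_le hw (by positivity : 0 ≤ w ^ 2) m.natAbs
  rw [show w ^ 2 / w = w by field_simp] at h1
  have h2 : ‖intExt neumannPart m P Q‖ ≤ _ :=
    norm_intExt_le (norm_neumannPart_le hP hQ hw _) (norm_neumannPart_le hQ hP hw _)
  set A : ℝ := ((m.natAbs - 1)! : ℝ) * w⁻¹ ^ m.natAbs
  have hA : 0 ≤ A := by positivity
  have h3 : ‖bess m P Q‖ ≤ A * Real.exp (2 * W ^ 2) := by
    calc _ ≤ A * Real.exp (w ^ 2) * Real.exp (w ^ 2) := h0.trans (by gcongr)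
      _ = A * Real.exp (2 * w ^ 2) := by rw [mul_assoc, ← Real.exp_add]; ring_nf
      _ ≤ _ := by gcongr
  have h4 : ‖1 + 2 * Complex.I / (Real.pi : ℂ) * L‖ ≤ 1 + 2 / Real.pi * Λ := by
    refine (norm_add_le _ _).trans ?_
    simp only [norm_one, norm_mul, norm_div, Complex.norm_I, Complex.norm_real, Real.norm_eq_abs,
      abs_of_pos hpi, Complex.norm_ofNat, mul_one]
    gcongr
  have h5 : ‖Complex.I / (Real.pi : ℂ)‖ = 1 / Real.pi := by
    simp [abs_of_pos hpi]
  refine (norm_sub_le _ _).trans ?_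
  rw [norm_mul, norm_mul, h5]
  calc _ ≤ (1 + 2 / Real.pi * Λ) * (A * Real.exp (2 * W ^ 2)) + 1 / Real.pi *
        (A * (Real.exp (W ^ 2) + 2 * digammaConst * Real.exp (4 * W ^ 2))) := by
        gcongr
        refine h2.trans ?_
        gcongr
    _ = _ := by unfold cylConst; ring

/-- A shift of the order by at most one is absorbed by passing from `(|n + m| - 1)!` to `|m|!` and
by the factor `1 + w + w⁻¹`; this loss does not affect summability. -/
lemma exists_norm_cyl_shift_le (hP : ‖P‖ = w) (hQ : ‖Q‖ = w) (hw : 0 < w) {n : ℤ}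
    (hn : n.natAbs ≤ 1) :
    ∃ C, 0 ≤ C ∧ ∀ m : ℤ, ‖cyl (n + m) P Q L‖ ≤ C * ((m.natAbs ! : ℝ) * w⁻¹ ^ m.natAbs) := by
  have hC : 0 < cylConst w ‖L‖ := cylConst_pos (norm_nonneg L)
  refine ⟨cylConst w ‖L‖ * (1 + w + w⁻¹), by positivity, fun m => ?_⟩
  refine (norm_cyl_le hP hQ hw le_rfl le_rfl (n + m)).trans ?_
  have hf : (((n + m).natAbs - 1)! : ℝ) ≤ (m.natAbs ! : ℝ) := by
    exact_mod_cast Nat.factorial_le (by omega)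
  have hp : w⁻¹ ^ (n + m).natAbs ≤ (1 + w + w⁻¹) * w⁻¹ ^ m.natAbs := by
    have hA : 0 ≤ w⁻¹ ^ m.natAbs := by positivity
    have hi : 0 < w⁻¹ := by positivity
    obtain h | h | h : (n + m).natAbs = m.natAbs ∨ (n + m).natAbs = m.natAbs + 1 ∨
        (n + m).natAbs + 1 = m.natAbs := by omega
    · rw [h]; nlinarith
    · rw [h, pow_succ]; nlinarith
    · have h' : w⁻¹ ^ (n + m).natAbs = w * w⁻¹ ^ m.natAbs := by
        rw [← h, pow_succ]; field_simp
      rw [h']; nlinarith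
  rw [mul_assoc]
  refine mul_le_mul_of_nonneg_left ?_ hC.le
  calc _ ≤ (m.natAbs ! : ℝ) * ((1 + w + w⁻¹) * w⁻¹ ^ m.natAbs) := by gcongr
    _ = _ := by ring

end Bounds

/-! ### Graf's addition theorem by regrouping a double series. -/

/-- Pairs of natural numbers by their difference and their minimum. -/
def diffMinEquiv : ℤ × ℕ ≃ ℕ × ℕ where
  toFun p := (p.2 + p.1.toNat, p.2 + (-p.1).toNat)
  invFun p := ((p.1 : ℤ) - p.2, min p.1 p.2)
  left_inv p := Prod.ext (by simp) (by simp; omega)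
  right_inv p := by ext <;> simp <;> omega

/-- This is the diagonal `b - a = m` of the product of the exponential series of `β` and `-α`, that
is, the generating function of the Bessel functions. -/
lemma hasSum_bess (m : ℤ) (β α : ℂ) :
    HasSum (fun l : ℕ => β ^ (l + m.toNat) / ((l + m.toNat)! : ℂ) *
      ((-α) ^ (l + (-m).toNat) / ((l + (-m).toNat)! : ℂ))) (bess m β α) := by
  have h : ∀ (n : ℕ) (P Q : ℂ), HasSum (fun l : ℕ => P ^ (l + n) / ((l + n)! : ℂ) *
      ((-Q) ^ l / (l ! : ℂ))) (besselPart n P Q) := fun n P Q => by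
    refine ((summable_entire (norm_phiCoeff_le n) (P * Q)).hasSum.mul_left (P ^ n)).congr_fun
      fun l => ?_
    rw [phiCoeff, neg_pow, pow_add, mul_pow, add_comm l n]
    have h1 : (l ! : ℂ) ≠ 0 := by exact_mod_cast l.factorial_ne_zero
    have h2 : ((n + l)! : ℂ) ≠ 0 := by exact_mod_cast (n + l).factorial_ne_zero
    field_simp
  rw [bess, intExt]
  split_ifs with hm
  · have e1 : m.toNat = m.natAbs := by omega
    have e2 : (-m).toNat = 0 := by omega
    rw [e1, e2]
    exact h _ _ _
  · have e1 : m.toNat = 0 := by omega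
    have e2 : (-m).toNat = m.natAbs := by omega
    rw [e1, e2]
    refine ((h m.natAbs α β).mul_left _).congr_fun fun l => ?_
    simp only [add_zero]
    rw [neg_pow α, neg_pow β, pow_add (-1 : ℂ)]
    ring

lemma summable_pow_natAbs {x : ℝ} (hx0 : 0 ≤ x) (hx1 : x < 1) :
    Summable fun m : ℤ => x ^ m.natAbs := by
  refine Summable.of_nat_of_neg ?_ ?_ <;> simpa using summable_geometric_of_lt_one hx0 hx1

/-- Graf's addition theorem. -/
theorem hasSum_graf {P Q α β : ℂ} {w v : ℝ} (hP : ‖P‖ = w) (hQ : ‖Q‖ = w) (hα : ‖α‖ = v)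
    (hβ : ‖β‖ = v) (hvw : v < w) (L : ℂ) {n : ℤ} (hn : n.natAbs ≤ 1) :
    HasSum (fun m : ℤ => cyl (n + m) P Q L * bess m β α)
      (cyl n (P - α) (Q - β)
        (L + Complex.log (1 - α / P) / 2 + Complex.log (1 - β / Q) / 2)) := by
  have hv : 0 ≤ v := hα ▸ norm_nonneg α
  have hw : 0 < w := hv.trans_lt hvw
  have hQ0 : Q ≠ 0 := norm_pos_iff.1 (hQ ▸ hw)
  have hPα : P - α ≠ 0 := fun h => by
    rw [sub_eq_zero] at h; rw [h, hα] at hP; exact hvw.ne hP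
  let f : ℕ × ℕ → ℂ := fun p => β ^ p.1 / (p.1 ! : ℂ) *
    ((-α) ^ p.2 / (p.2 ! : ℂ) * cyl (n + p.1 - p.2) P Q L)
  have hfe : ∀ (m : ℤ) (l : ℕ), f (diffMinEquiv (m, l)) = cyl (n + m) P Q L *
      (β ^ (l + m.toNat) / ((l + m.toNat)! : ℂ) *
        ((-α) ^ (l + (-m).toNat) / ((l + (-m).toNat)! : ℂ))) := fun m l => by
    have : n + ((l + m.toNat : ℕ) : ℤ) - ((l + (-m).toNat : ℕ) : ℤ) = n + m := by
      push_cast; omega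
    simp only [f, diffMinEquiv, Equiv.coe_fn_mk, this]
    ring
  have hsum : Summable (f ∘ diffMinEquiv) := by
    obtain ⟨C, hC0, hC⟩ := exists_norm_cyl_shift_le (L := L) hP hQ hw hn
    have hx1 : v / w < 1 := (div_lt_one hw).2 hvw
    have h1 := summable_pow_natAbs (div_nonneg hv hw.le) hx1
    have h2 := Real.summable_pow_div_factorial (v ^ 2)
    have h3 := (h1.mul_of_nonneg h2 (fun _ => by positivity) (fun _ => by positivity)).mul_left C
    refine .of_norm_bounded h3 ?_
    rintro ⟨m, l⟩
    rw [Function.comp, hfe]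
    simp only [norm_mul, norm_div, norm_pow, norm_neg, hα, hβ, Complex.norm_natCast]
    -- One of the two shifts vanishes and the other is `|m|`. The resulting `|m|!` cancels the
    -- growth of `cyl`, leaving `(v/w)^{|m|} (v²)^l / l!`.
    have hfac : (l ! : ℝ) * (m.natAbs ! : ℝ) ≤
        ((l + m.toNat)! : ℝ) * ((l + (-m).toNat)! : ℝ) := by
      rcases le_total 0 m with h | h
      · rw [show (-m).toNat = 0 by omega, show m.toNat = m.natAbs by omega, mul_comm]
        gcongr <;> omega
      · rw [show m.toNat = 0 by omega, show (-m).toNat = m.natAbs by omega]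
        gcongr <;> omega
    have hexp : v ^ (l + m.toNat) * v ^ (l + (-m).toNat) = (v ^ 2) ^ l * v ^ m.natAbs := by
      rw [← pow_add, ← pow_mul, ← pow_add]; congr 1; omega
    calc _ ≤ C * ((m.natAbs ! : ℝ) * w⁻¹ ^ m.natAbs) *
          ((v ^ 2) ^ l * v ^ m.natAbs / ((l ! : ℝ) * (m.natAbs ! : ℝ))) := by
          rw [div_mul_div_comm, hexp]
          gcongr
          exact hC m
      _ = _ := by
          have : (m.natAbs ! : ℝ) ≠ 0 := by positivity
          rw [div_pow, inv_pow]
          field_simp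
  have hsum' : Summable f := diffMinEquiv.summable_iff.1 hsum
  have hinner : ∀ b : ℕ, HasSum (fun a : ℕ => f (b, a)) (β ^ b / (b ! : ℂ) *
      cyl (n + b) (P - α) Q (L + Complex.log (1 - α / P) / 2)) := fun b => by
    refine ((hasSum_cyl_sub_left hQ0 (hα.trans_lt (hvw.trans_eq hP.symm)) L (n + b)).mul_left
      (β ^ b / (b ! : ℂ))).congr_fun fun a => ?_
    ring
  have htot : HasSum f (cyl n (P - α) (Q - β)
      (L + Complex.log (1 - α / P) / 2 + Complex.log (1 - β / Q) / 2)) := by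
    have h1 := hsum'.hasSum.prod_fiberwise hinner
    have h2 := hasSum_cyl_sub_right (P := P - α) (Q := Q) (z := β) hPα
      (hβ.trans_lt (hvw.trans_eq hQ.symm)) (L + Complex.log (1 - α / P) / 2) n
    exact h1.unique h2 ▸ hsum'.hasSum
  -- Absolute convergence allows the sum, already evaluated by rows, to be taken along diagonals
  -- instead.
  refine (diffMinEquiv.hasSum_iff.2 htot).prod_fiberwise fun m => ?_
  simp only [Function.comp, hfe]
  exact (hasSum_bess m β α).mul_left _

open Filter Topology

/-! ### Identification with the classical Bessel and Hankel functions. -/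

section Bridge

lemma besselJNat_eq (n : ℕ) (z : ℂ) : besselJNat n z = (z / 2) ^ n * phi n ((z / 2) ^ 2) := by
  rw [besselJNat, phi, ← tsum_mul_left]
  refine tsum_congr fun l => ?_
  rw [phiCoeff, pow_add, pow_mul]; ring

lemma besselJNat_mul_pow {u : ℂ} (hu : u ≠ 0) (n : ℕ) (z : ℂ) :
    besselJNat n z * u ^ n = besselPart n (z / 2 * u) (z / 2 * u⁻¹) := by
  have h : z / 2 * u * (z / 2 * u⁻¹) = (z / 2) ^ 2 := by field_simp
  rw [besselJNat_eq, besselPart, h, mul_pow]; ring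

lemma hankelNat_mul_pow {u : ℂ} (hu : u ≠ 0) (n : ℕ) (z : ℂ) :
    hankelNat n z * u ^ n =
      (1 + 2 * Complex.I / (Real.pi : ℂ) * Complex.log (z / 2)) *
          besselPart n (z / 2 * u) (z / 2 * u⁻¹)
        - Complex.I / (Real.pi : ℂ) * neumannPart n (z / 2 * u) (z / 2 * u⁻¹) := by
  have h : z / 2 * u * (z / 2 * u⁻¹) = (z / 2) ^ 2 := by field_simp
  have h1 : ∑ l ∈ Finset.range n, ((n - 1 - l)! : ℂ) / (l ! : ℂ) * (z / 2) ^ (2 * l) =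
      sing n ((z / 2) ^ 2) := by
    simp only [sing, pow_mul]
  have h2 : ∑' l : ℕ, (Complex.digamma ((l : ℂ) + 1) + Complex.digamma ((n : ℂ) + (l : ℂ) + 1)) *
        ((-1 : ℂ) ^ l / ((l ! : ℂ) * ((n + l)! : ℂ))) * (z / 2) ^ (2 * l) =
      psi n ((z / 2) ^ 2) := by
    simp only [psi, psiCoeff, phiCoeff, pow_mul]
  have h3 : (z / 2 * u⁻¹)⁻¹ = 2 / z * u := by rw [mul_inv, inv_inv, inv_div]
  rw [← besselJNat_mul_pow hu, neumannPart, h, h3, hankelNat, besselYNat, h1, h2, mul_pow, mul_pow]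
  ring

lemma besselJ_mul_zpow {u : ℂ} (hu : u ≠ 0) (m : ℤ) (z : ℂ) :
    besselJ m z * u ^ m = bess m (z / 2 * u) (z / 2 * u⁻¹) := by
  rw [besselJ, bess, intExt]
  split_ifs with hm
  · rw [← besselJNat_mul_pow hu, ← zpow_natCast, Int.natAbs_of_nonneg hm]
  · have h := besselJNat_mul_pow (inv_ne_zero hu) m.natAbs z
    rw [inv_inv] at h
    rw [← h, inv_pow, ← zpow_natCast u, Int.ofNat_natAbs_of_nonpos (by omega), ← zpow_neg, neg_neg,
      mul_assoc]

lemma hankel_mul_zpow {u : ℂ} (hu : u ≠ 0) (m : ℤ) (z : ℂ) :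
    hankel m z * u ^ m = cyl m (z / 2 * u) (z / 2 * u⁻¹) (Complex.log (z / 2)) := by
  rw [hankel, cyl, bess, intExt, intExt]
  split_ifs with hm
  · rw [← hankelNat_mul_pow hu, ← zpow_natCast, Int.natAbs_of_nonneg hm]
  · have h := hankelNat_mul_pow (inv_ne_zero hu) m.natAbs z
    rw [inv_inv, inv_pow, ← zpow_natCast u, Int.ofNat_natAbs_of_nonpos (by omega), ← zpow_neg,
      neg_neg] at h
    rw [mul_assoc, h]
    ring

end Bridge

/-! ### Translation to vectors of the plane. -/

/-- The isometric identification of the plane with `ℂ`. -/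
def toComplex : Plane ≃ₗᵢ[ℝ] ℂ := Complex.orthonormalBasisOneI.repr.symm

lemma toComplex_apply (v : Plane) : toComplex v = ⟨v 0, v 1⟩ := by
  rw [toComplex, Complex.orthonormalBasisOneI_repr_symm_apply]
  apply Complex.ext <;> simp

/-- `k ξ / 2` for the complex form `ξ` of `v`. -/
def wave (k : ℂ) (v : Plane) : ℂ := k / 2 * toComplex v

/-- `k ξ̄ / 2` for the complex form `ξ` of `v`. -/
def waveConj (k : ℂ) (v : Plane) : ℂ := k / 2 * (starRingEnd ℂ) (toComplex v)

/-- The unit complex number in the direction of `v`. -/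
def unitDir (v : Plane) : ℂ := Complex.exp (polarAngle v * Complex.I)

lemma unitDir_ne_zero (v : Plane) : unitDir v ≠ 0 := Complex.exp_ne_zero _

lemma toComplex_eq (v : Plane) : toComplex v = (‖v‖ : ℂ) * unitDir v := by
  rw [← toComplex.norm_map v, unitDir, polarAngle, ← toComplex_apply,
    Complex.norm_mul_exp_arg_mul_I]

lemma conj_unitDir (v : Plane) : (starRingEnd ℂ) (unitDir v) = (unitDir v)⁻¹ := by
  rw [unitDir, ← Complex.exp_conj, ← Complex.exp_neg]
  simp

variable (k : ℂ) (u v : Plane)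

lemma wave_eq : wave k v = k * (‖v‖ : ℂ) / 2 * unitDir v := by
  rw [wave, toComplex_eq]; ring

lemma waveConj_eq : waveConj k v = k * (‖v‖ : ℂ) / 2 * (unitDir v)⁻¹ := by
  rw [waveConj, toComplex_eq, map_mul, conj_unitDir, Complex.conj_ofReal]; ring

lemma norm_wave : ‖wave k v‖ = ‖k‖ / 2 * ‖v‖ := by
  rw [wave, norm_mul, toComplex.norm_map, norm_div, Complex.norm_ofNat]

lemma norm_waveConj : ‖waveConj k v‖ = ‖k‖ / 2 * ‖v‖ := by
  rw [waveConj, norm_mul, Complex.norm_conj, toComplex.norm_map, norm_div, Complex.norm_ofNat]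

lemma wave_sub : wave k (u - v) = wave k u - wave k v := by
  rw [wave, map_sub]; simp only [wave]; ring

lemma waveConj_sub : waveConj k (u - v) = waveConj k u - waveConj k v := by
  rw [waveConj, map_sub, map_sub]; simp only [waveConj]; ring

lemma wave_smul (t : ℝ) : wave k (t • v) = t * wave k v := by
  rw [wave, map_smul, wave, Complex.real_smul]; ring

lemma waveConj_smul (t : ℝ) : waveConj k (t • v) = t * waveConj k v := by
  rw [waveConj, map_smul, waveConj, Complex.real_smul, map_mul, Complex.conj_ofReal]; ring

variable {k u v}

/-- The logarithm entering `cyl` for the field at the vector `v`. -/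
def waveLog (k : ℂ) (v : Plane) : ℂ := Complex.log (k * (‖v‖ : ℂ) / 2)

lemma waveLog_eq (hk : k ≠ 0) (hv : v ≠ 0) :
    waveLog k v = (Real.log ‖v‖ : ℂ) + Complex.log (k / 2) := by
  rw [waveLog, show k * (‖v‖ : ℂ) / 2 = (‖v‖ : ℂ) * (k / 2) by ring,
    Complex.log_ofReal_mul (norm_pos_iff.2 hv) (by simpa using hk)]

/-- The two logarithms have complex conjugate arguments in the right half-plane, so their half-sum
is the real number `log |1 - q|`. Only positive real factors multiply `k`, and the principal branch
is preserved. -/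
lemma waveLog_sub (hk : k ≠ 0) (h : ‖v‖ < ‖u‖) :
    waveLog k u + Complex.log (1 - wave k v / wave k u) / 2
      + Complex.log (1 - waveConj k v / waveConj k u) / 2 = waveLog k (u - v) := by
  have hu : u ≠ 0 := norm_pos_iff.1 ((norm_nonneg v).trans_lt h)
  have huv : u - v ≠ 0 := fun h' => by rw [sub_eq_zero.1 h'] at h; exact lt_irrefl _ h
  have hk2 : k / 2 ≠ 0 := by simpa using hk
  have hcu : toComplex u ≠ 0 := by simpa using hu
  set q := toComplex v / toComplex u with hq
  have e1 : wave k v / wave k u = q := mul_div_mul_left _ _ hk2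
  have e2 : waveConj k v / waveConj k u = (starRingEnd ℂ) q := by
    rw [waveConj, waveConj, mul_div_mul_left _ _ hk2, hq, map_div₀]
  have hs : 1 - q ∈ Complex.slitPlane := one_sub_div_mem_slitPlane (by simpa using h)
  have e3 : Complex.log (1 - (starRingEnd ℂ) q) = (starRingEnd ℂ) (Complex.log (1 - q)) := by
    rw [← Complex.log_conj _ (Complex.mem_slitPlane_iff_arg.1 hs).1, map_sub, map_one]
  have e4 : Complex.log (1 - q) / 2 + (starRingEnd ℂ) (Complex.log (1 - q)) / 2 =
      (Real.log ‖1 - q‖ : ℂ) := by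
    rw [← add_div, Complex.add_conj, Complex.log_re]; push_cast; ring
  have e5 : ‖u - v‖ = ‖u‖ * ‖1 - q‖ := by
    rw [← toComplex.norm_map (u - v), ← toComplex.norm_map u, ← norm_mul, hq, map_sub]
    congr 1; field_simp
  have h1 : ‖1 - q‖ ≠ 0 := norm_ne_zero_iff.2 (Complex.slitPlane_ne_zero hs)
  rw [waveLog_eq hk hu, waveLog_eq hk huv, e1, e2, e3, e5,
    Real.log_mul (norm_ne_zero_iff.2 hu) h1, add_assoc, e4]
  push_cast; ring

lemma green_eq (k : ℂ) (v : Plane) :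
    green v k = Complex.I / 4 * cyl 0 (wave k v) (waveConj k v) (waveLog k v) := by
  rw [green, wave_eq, waveConj_eq, waveLog, ← hankel_mul_zpow (unitDir_ne_zero v)]
  simp

/-- In this form the dependence on `y` is through entire functions of `wave` and `waveConj`, so the
jump of the polar angle and the centre `y = xj` cause no trouble. -/
lemma greenTrunc_eq (xj : Plane) (M : ℕ) (x y : Plane) (k : ℂ) :
    greenTrunc xj M x y k = Complex.I / 4 * ∑ m ∈ Finset.Icc (-(M : ℤ)) (M : ℤ),
      cyl m (wave k (x - xj)) (waveConj k (x - xj)) (waveLog k (x - xj)) *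
        bess m (waveConj k (y - xj)) (wave k (y - xj)) := by
  rw [greenTrunc]
  congr 1
  refine Finset.sum_congr rfl fun m _ => ?_
  have h1 := hankel_mul_zpow (unitDir_ne_zero (x - xj)) m (k * (‖x - xj‖ : ℂ))
  have h2 := besselJ_mul_zpow (inv_ne_zero (unitDir_ne_zero (y - xj))) m (k * (‖y - xj‖ : ℂ))
  rw [inv_inv] at h2
  rw [wave_eq, waveConj_eq, wave_eq, waveConj_eq, waveLog, ← h1, ← h2]
  have h3 : Complex.exp (Complex.I * (m : ℂ) *
      ((polarAngle (x - xj) - polarAngle (y - xj) : ℝ) : ℂ)) =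
      unitDir (x - xj) ^ m * (unitDir (y - xj))⁻¹ ^ m := by
    rw [unitDir, unitDir, ← Complex.exp_neg, ← Complex.exp_int_mul, ← Complex.exp_int_mul,
      ← Complex.exp_add]
    push_cast
    congr 1; ring
  rw [h3]; ring

/-- Graf's addition theorem for the fields of orders `-1, 0, 1` in the plane. -/
lemma hasSum_graf_plane (hk : k ≠ 0) (h : ‖v‖ < ‖u‖) {n : ℤ} (hn : n.natAbs ≤ 1) :
    HasSum (fun m : ℤ => cyl (n + m) (wave k u) (waveConj k u) (waveLog k u) *
        bess m (waveConj k v) (wave k v))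
      (cyl n (wave k (u - v)) (waveConj k (u - v)) (waveLog k (u - v))) := by
  have hk2 : 0 < ‖k‖ / 2 := by have := norm_pos_iff.2 hk; positivity
  have key := hasSum_graf (norm_wave k u) (norm_waveConj k u) (norm_wave k v) (norm_waveConj k v)
    (mul_lt_mul_of_pos_left h hk2) (waveLog k u) hn
  rwa [waveLog_sub hk h, ← wave_sub, ← waveConj_sub] at key

/-! ### Derivatives with respect to the source point. -/

section Differentiability

/-- Along a line `wave` and `waveConj` are affine in `t`, so `t` may be complexified,
`hasDerivAt_cyl` applied, and the result restricted to real `t`. `waveLog_sub` identifies the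
logarithm for small `t`. -/
lemma hasDerivAt_green_line (hk : k ≠ 0) (hv : v ≠ 0) (ν : Plane) :
    HasDerivAt (fun t : ℝ => green (v - t • ν) k)
      (Complex.I / 4 * (-wave k ν * cyl (-1) (wave k v) (waveConj k v) (waveLog k v)
        + waveConj k ν * cyl 1 (wave k v) (waveConj k v) (waveLog k v))) 0 := by
  have hnv : 0 < ‖v‖ := norm_pos_iff.2 hv
  have hk2 : 0 < ‖k‖ / 2 := by have := norm_pos_iff.2 hk; positivity
  have hP : wave k v ≠ 0 := norm_pos_iff.1 (by rw [norm_wave]; positivity)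
  have hQ : waveConj k v ≠ 0 := norm_pos_iff.1 (by rw [norm_waveConj]; positivity)
  have hlin : ∀ c : ℂ, HasDerivAt (fun t : ℂ => t * c) c 0 := fun c => by
    simpa using (hasDerivAt_id (0 : ℂ)).mul_const c
  have hP' : HasDerivAt (fun t : ℂ => wave k v - t * wave k ν) (-wave k ν) 0 :=
    (hlin _).const_sub _
  have hQ' : HasDerivAt (fun t : ℂ => waveConj k v - t * waveConj k ν) (-waveConj k ν) 0 :=
    (hlin _).const_sub _
  have hlog : ∀ c d : ℂ, HasDerivAt (fun t : ℂ => Complex.log (1 - t * c / d) / 2)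
      (-c / d / 2) 0 := fun c d => by
    have h := ((((hlin c).div_const d).const_sub 1).clog (by simp)).div_const 2
    exact h.congr_deriv (by simp [neg_div])
  have hL : HasDerivAt (fun t : ℂ => waveLog k v + Complex.log (1 - t * wave k ν / wave k v) / 2
      + Complex.log (1 - t * waveConj k ν / waveConj k v) / 2)
      ((-wave k ν / wave k v + -waveConj k ν / waveConj k v) / 2) 0 :=
    (((hlog _ _).const_add _).add (hlog _ _)).congr_deriv (by ring)
  have key := (hasDerivAt_cyl hP' hQ' (by simpa using hL) (by simpa using hP) (by simpa using hQ)
    0).const_mul (Complex.I / 4)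
  have key' := HasDerivAt.comp_ofReal (z := 0) (by simpa only [Complex.ofReal_zero] using key)
  refine (key'.congr_deriv ?_).congr_of_eventuallyEq ?_
  · simp
  · have hlim : Tendsto (fun t : ℝ => ‖t • ν‖) (𝓝 0) (𝓝 0) := by
      have : Continuous fun t : ℝ => ‖t • ν‖ := by fun_prop
      simpa using this.tendsto 0
    filter_upwards [hlim.eventually_lt_const hnv] with t ht
    rw [green_eq, ← waveLog_sub hk ht, wave_sub, waveConj_sub, wave_smul, waveConj_smul]

lemma hasDerivAt_greenTrunc_line (xj : Plane) (M : ℕ) (x y ν : Plane) (k : ℂ) :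
    HasDerivAt (fun t : ℝ => greenTrunc xj M x (y + t • ν) k)
      (Complex.I / 4 * ∑ m ∈ Finset.Icc (-(M : ℤ)) (M : ℤ),
        cyl m (wave k (x - xj)) (waveConj k (x - xj)) (waveLog k (x - xj)) *
          (waveConj k ν * bess (m - 1) (waveConj k (y - xj)) (wave k (y - xj))
            - wave k ν * bess (m + 1) (waveConj k (y - xj)) (wave k (y - xj)))) 0 := by
  have hlin : ∀ c d : ℂ, HasDerivAt (fun t : ℂ => d - (-t) * c) c 0 := fun c d => by
    simpa using ((hasDerivAt_id (0 : ℂ)).mul_const c).const_add d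
  have key := (HasDerivAt.fun_sum (u := Finset.Icc (-(M : ℤ)) (M : ℤ)) fun m _ =>
    (hasDerivAt_bess (hlin (waveConj k ν) (waveConj k (y - xj)))
      (hlin (wave k ν) (wave k (y - xj))) m).const_mul
      (cyl m (wave k (x - xj)) (waveConj k (x - xj)) (waveLog k (x - xj)))).const_mul
      (Complex.I / 4)
  have key' := HasDerivAt.comp_ofReal (z := 0) (by simpa only [Complex.ofReal_zero] using key)
  refine (key'.congr_deriv ?_).congr_of_eventuallyEq (.of_forall fun t => ?_)
  · simp
  · have h : y + t • ν - xj = (y - xj) - (-t) • ν := by rw [neg_smul]; abel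
    simp only [greenTrunc_eq, h, wave_sub, waveConj_sub, wave_smul, waveConj_smul,
      Complex.ofReal_neg]

lemma differentiable_wave (k : ℂ) : Differentiable ℝ (wave k) :=
  toComplex.toContinuousLinearEquiv.differentiable.const_mul (k / 2)

lemma differentiable_waveConj (k : ℂ) : Differentiable ℝ (waveConj k) :=
  (Complex.conjCLE.differentiable.comp
    toComplex.toContinuousLinearEquiv.differentiable).const_mul (k / 2)

variable {E : Type*} [NormedAddCommGroup E] [NormedSpace ℝ E] {f g : E → ℂ} {e : E}

lemma differentiableAt_besselPart (hf : DifferentiableAt ℝ f e) (hg : DifferentiableAt ℝ g e)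
    (n : ℕ) : DifferentiableAt ℝ (fun e => besselPart n (f e) (g e)) e :=
  (hf.fun_pow n).mul (((hasDerivAt_phi n _).differentiableAt.restrictScalars ℝ).comp e (hf.mul hg))

lemma differentiableAt_bess (hf : DifferentiableAt ℝ f e) (hg : DifferentiableAt ℝ g e)
    (m : ℤ) : DifferentiableAt ℝ (fun e => bess m (f e) (g e)) e := by
  unfold bess intExt
  split_ifs
  · exact differentiableAt_besselPart hf hg _
  · exact (differentiableAt_besselPart hg hf _).const_mul _

lemma differentiableAt_greenTrunc (xj : Plane) (M : ℕ) (x y : Plane) (k : ℂ) :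
    DifferentiableAt ℝ (fun y' => greenTrunc xj M x y' k) y := by
  simp only [greenTrunc_eq]
  have hs : DifferentiableAt ℝ (fun y' : Plane => y' - xj) y := by fun_prop
  refine DifferentiableAt.const_mul (DifferentiableAt.fun_sum fun m _ => ?_) _
  exact (differentiableAt_bess ((differentiable_waveConj k _).comp y hs)
    ((differentiable_wave k _).comp y hs) m).const_mul _

lemma differentiableAt_green (hk : k ≠ 0) {x y : Plane} (hxy : x - y ≠ 0) :
    DifferentiableAt ℝ (fun y' => green (x - y') k) y := by
  have hs : DifferentiableAt ℝ (fun y' : Plane => x - y') y := by fun_prop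
  have hP := (differentiable_wave k _).comp y hs
  have hQ := (differentiable_waveConj k _).comp y hs
  have hL : DifferentiableAt ℝ (fun y' => waveLog k (x - y')) y := by
    have h1 : DifferentiableAt ℝ (fun y' => (Real.log ‖x - y'‖ : ℂ) + Complex.log (k / 2)) y :=
      (Complex.ofRealCLM.differentiableAt.comp y
        ((hs.norm ℝ hxy).log (norm_ne_zero_iff.2 hxy))).add_const _
    refine h1.congr_of_eventuallyEq ?_
    filter_upwards [hs.continuousAt.eventually_ne hxy] with y' hy' using waveLog_eq hk hy'
  have hN : ∀ P Q, intExt neumannPart 0 P Q = psi 0 (P * Q) := fun P Q => by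
    simp [intExt, neumannPart, sing]
  simp only [green_eq, cyl, hN]
  exact ((((hL.const_mul _).const_add _).mul (differentiableAt_bess hP hQ 0)).sub
    ((((hasDerivAt_psi 0 _).differentiableAt.restrictScalars ℝ).comp y
      (hP.mul hQ)).const_mul _)).const_mul _

end Differentiability

/-! ### Tails of two-sided series. -/

section Tail

lemma norm_sub_sum_Icc_le {f : ℤ → ℂ} {S : ℂ} {g : ℕ → ℝ} {T : ℝ} (M : ℕ) (hf : HasSum f S)
    (hg : HasSum (fun n => g (n + (M + 1))) T)
    (hfg : ∀ m : ℤ, M < m.natAbs → ‖f m‖ ≤ g m.natAbs) :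
    ‖S - ∑ m ∈ Finset.Icc (-(M : ℤ)) (M : ℤ), f m‖ ≤ 2 * T := by
  -- Setting the majorant to zero up to `M` lets the orders of each sign contribute exactly `T`;
  -- order zero is counted once, with value zero.
  let G : ℕ → ℝ := fun n => if n ≤ M then 0 else g n
  have hG : HasSum G T := by
    have h0 : ∑ i ∈ Finset.range (M + 1), G i = 0 :=
      Finset.sum_eq_zero fun i hi => if_pos (by simpa [Nat.lt_succ_iff] using hi)
    rw [← add_zero T, ← h0]
    refine (hasSum_nat_add_iff (M + 1)).1 (hg.congr_fun fun n => if_neg (by omega))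
  have hG1 : HasSum (fun n => G (n + 1)) T := by
    have h := (hasSum_nat_add_iff' 1).2 hG
    simpa [G] using h
  have hGZ : HasSum (fun m : ℤ => G m.natAbs) (T + T) :=
    HasSum.of_nat_of_neg_add_one (by simpa using hG)
      (hG1.congr_fun fun n => by congr 1)
  set s := Finset.Icc (-(M : ℤ)) (M : ℤ) with hs
  have hfin : HasSum (fun m => if m ∈ s then f m else 0) (∑ m ∈ s, f m) := by
    have h := hasSum_sum_of_ne_finset_zero (f := fun m => if m ∈ s then f m else 0) (s := s)
      (L := SummationFilter.unconditional ℤ) fun b hb => if_neg hb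
    rwa [Finset.sum_congr rfl fun m hm => if_pos hm] at h
  rw [two_mul]
  refine (hf.sub hfin).norm_le_of_bounded hGZ fun m => ?_
  by_cases hm : m ∈ s
  · have : m.natAbs ≤ M := by rw [hs, Finset.mem_Icc] at hm; omega
    simp [hm, G, this]
  · have : M < m.natAbs := by rw [hs, Finset.mem_Icc] at hm; omega
    simpa [hm, G, this.not_ge] using hfg m this

lemma hasSum_log_tail {a : ℝ} (h0 : 0 ≤ a) (h1 : a < 1) (M : ℕ) :
    HasSum (fun n : ℕ => a ^ (n + (M + 1)) / ((n + (M + 1) : ℕ) : ℝ))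
      (-Real.log (1 - a) - ∑ m ∈ Finset.Icc 1 M, a ^ m / (m : ℝ)) := by
  have h := (hasSum_nat_add_iff' M).2
    (Real.hasSum_pow_div_log_of_abs_lt_one (x := a) (by rwa [abs_of_nonneg h0]))
  have hs : ∑ m ∈ Finset.Icc 1 M, a ^ m / (m : ℝ) =
      ∑ i ∈ Finset.range M, a ^ (i + 1) / ((i : ℝ) + 1) := by
    rw [Finset.range_eq_Ico, ← Finset.Ico_succ_right_eq_Icc, Nat.succ_eq_succ, Nat.succ_eq_add_one,
      ← Finset.sum_Ico_add' (fun m : ℕ => a ^ m / (m : ℝ)) 0 M 1]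
    push_cast
    rfl
  rw [hs]
  refine h.congr_fun fun n => ?_
  push_cast
  ring_nf

lemma hasSum_geometric_tail {a : ℝ} (h0 : 0 ≤ a) (h1 : a < 1) (M : ℕ) :
    HasSum (fun n : ℕ => a ^ (n + (M + 1))) (a ^ (M + 1) / (1 - a)) := by
  refine ((hasSum_geometric_of_lt_one h0 h1).mul_left (a ^ (M + 1))).congr_fun fun n => ?_
  rw [pow_add]; ring

end Tail

/-! ### Bounds for single terms of the expansions. -/

section TermBounds

variable {k : ℂ} {u v : Plane} {R W Λ B : ℝ}

lemma norm_cyl_mul_bess_le (hk : k ≠ 0) (hv : ‖v‖ ≤ R) (hu : R < ‖u‖) (hW : ‖k‖ / 2 * ‖u‖ ≤ W)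
    (hΛ : ‖waveLog k u‖ ≤ Λ) (m j : ℤ) :
    ‖cyl m (wave k u) (waveConj k u) (waveLog k u) * bess j (waveConj k v) (wave k v)‖ ≤
      cylConst W Λ * Real.exp (W ^ 2) *
        (((m.natAbs - 1)! : ℝ) / (j.natAbs ! : ℝ) *
          ((‖k‖ / 2 * ‖u‖)⁻¹ ^ m.natAbs * (‖k‖ / 2 * ‖v‖) ^ j.natAbs)) := by
  have hk2 : 0 < ‖k‖ / 2 := by have := norm_pos_iff.2 hk; positivity
  have hu0 : 0 < ‖u‖ := (norm_nonneg v).trans_lt (hv.trans_lt hu)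
  have hvW : ‖k‖ / 2 * ‖v‖ ≤ W :=
    (mul_le_mul_of_nonneg_left (hv.trans hu.le) hk2.le).trans hW
  have h1 := norm_cyl_le (norm_wave k u) (norm_waveConj k u) (by positivity) hW hΛ m
  have h2 := norm_bess_le (norm_waveConj k v) (norm_wave k v) j
  have hC : 0 < cylConst W Λ := cylConst_pos ((norm_nonneg _).trans hΛ)
  rw [norm_mul]
  calc _ ≤ _ := mul_le_mul h1 h2 (norm_nonneg _) (by positivity)
    _ ≤ cylConst W Λ * (((m.natAbs - 1)! : ℝ) * (‖k‖ / 2 * ‖u‖)⁻¹ ^ m.natAbs) *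
        ((‖k‖ / 2 * ‖v‖) ^ j.natAbs / (j.natAbs ! : ℝ) * Real.exp (W ^ 2)) := by gcongr
    _ = _ := by ring

lemma norm_monopole_term_le (hk : k ≠ 0) (hv : ‖v‖ ≤ R) (hu : R < ‖u‖)
    (hW : ‖k‖ / 2 * ‖u‖ ≤ W) (hΛ : ‖waveLog k u‖ ≤ Λ) {m : ℤ} (hm : 0 < m.natAbs) :
    ‖cyl m (wave k u) (waveConj k u) (waveLog k u) * bess m (waveConj k v) (wave k v)‖ ≤
      cylConst W Λ * Real.exp (W ^ 2) * ((R / ‖u‖) ^ m.natAbs / (m.natAbs : ℝ)) := by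
  have hk2 : 0 < ‖k‖ / 2 := by have := norm_pos_iff.2 hk; positivity
  have hu0 : 0 < ‖u‖ := (norm_nonneg v).trans_lt (hv.trans_lt hu)
  have hC : 0 < cylConst W Λ := cylConst_pos ((norm_nonneg _).trans hΛ)
  refine (norm_cyl_mul_bess_le hk hv hu hW hΛ m m).trans ?_
  refine mul_le_mul_of_nonneg_left ?_ (by positivity)
  generalize m.natAbs = n at *
  obtain ⟨n, rfl⟩ : ∃ l, n = l + 1 := ⟨n - 1, by omega⟩
  have h1 : (((n + 1 - 1)! : ℕ) : ℝ) / ((n + 1)! : ℝ) = 1 / ((n + 1 : ℕ) : ℝ) := by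
    rw [Nat.add_sub_cancel, Nat.factorial_succ]
    have : (n ! : ℝ) ≠ 0 := by positivity
    push_cast
    field_simp
  have h2 : (‖k‖ / 2 * ‖u‖)⁻¹ ^ (n + 1) * (‖k‖ / 2 * ‖v‖) ^ (n + 1) = (‖v‖ / ‖u‖) ^ (n + 1) := by
    rw [← mul_pow]; congr 1; field_simp
  rw [h1, h2, one_div_mul_eq_div]
  gcongr

/-- The factor `‖k‖ / 2`, which comes from differentiating `wave` or `waveConj`, leaves `κ⁰` when
the order of `bess` is lowered and `κ²` when it is raised, so nothing blows up for small `k`. -/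
lemma norm_dipole_term_le (hk : k ≠ 0) (hv : ‖v‖ ≤ R) (hu : R < ‖u‖)
    (hW : ‖k‖ / 2 * ‖u‖ ≤ W) (hΛ : ‖waveLog k u‖ ≤ Λ) (hB : ‖k‖ / 2 ≤ B) {m j : ℤ}
    (hm : 2 ≤ m.natAbs) (hj : j.natAbs + 1 = m.natAbs ∨ j.natAbs = m.natAbs + 1) :
    ‖k‖ / 2 * ‖cyl m (wave k u) (waveConj k u) (waveLog k u) *
        bess j (waveConj k v) (wave k v)‖ ≤
      cylConst W Λ * Real.exp (W ^ 2) * (R⁻¹ + B ^ 2 * R) * (R / ‖u‖) ^ m.natAbs := by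
  have hk2 : 0 < ‖k‖ / 2 := by have := norm_pos_iff.2 hk; positivity
  have hv0 := norm_nonneg v
  have hR : 0 ≤ R := hv0.trans hv
  have hu0 : 0 < ‖u‖ := hR.trans_lt hu
  have hC : 0 < cylConst W Λ := cylConst_pos ((norm_nonneg _).trans hΛ)
  have h := norm_cyl_mul_bess_le hk hv hu hW hΛ m j
  have hfac : ((m.natAbs - 1)! : ℝ) / (j.natAbs ! : ℝ) ≤ 1 := by
    rw [div_le_one (by positivity)]
    exact_mod_cast Nat.factorial_le (by omega)
  have hpow : ‖k‖ / 2 * ((‖k‖ / 2 * ‖u‖)⁻¹ ^ m.natAbs * (‖k‖ / 2 * ‖v‖) ^ j.natAbs) ≤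
      (R⁻¹ + B ^ 2 * R) * (R / ‖u‖) ^ m.natAbs := by
    generalize ‖k‖ / 2 = κ at *
    generalize j.natAbs = i at *
    generalize m.natAbs = n at *
    have hi : 0 ≤ R⁻¹ := inv_nonneg.2 hR
    have hun : 0 < ‖u‖⁻¹ ^ n := by positivity
    rcases hj with rfl | rfl
    · have e1 : κ * ((κ * ‖u‖)⁻¹ ^ (i + 1) * (κ * ‖v‖) ^ i) = ‖v‖ ^ i * ‖u‖⁻¹ ^ (i + 1) := by
        rw [mul_inv, mul_pow, mul_pow, inv_pow]; field_simp; ring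
      have e2 : ‖v‖ ^ i ≤ R⁻¹ * R ^ (i + 1) := by
        -- For `R = 0` the convention `R⁻¹ = 0` makes the right side vanish. The left side vanishes
        -- too, because `|m| ≥ 2` forces `i ≥ 1`.
        rcases hR.eq_or_lt with h0 | h0
        · have : ‖v‖ = 0 := le_antisymm (h0 ▸ hv) hv0
          rw [this, zero_pow (by omega)]; positivity
        · rw [pow_succ, mul_comm, mul_assoc, mul_inv_cancel₀ h0.ne', mul_one]
          gcongr
      rw [e1, div_eq_mul_inv, mul_pow]
      calc _ ≤ R⁻¹ * R ^ (i + 1) * ‖u‖⁻¹ ^ (i + 1) := by gcongr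
        _ ≤ (R⁻¹ + B ^ 2 * R) * R ^ (i + 1) * ‖u‖⁻¹ ^ (i + 1) := by
          gcongr
          have : 0 ≤ B ^ 2 * R := by positivity
          linarith
        _ = _ := by ring
    · have e1 : κ * ((κ * ‖u‖)⁻¹ ^ n * (κ * ‖v‖) ^ (n + 1)) =
          κ ^ 2 * (‖v‖ ^ (n + 1) * ‖u‖⁻¹ ^ n) := by
        rw [mul_inv, mul_pow, mul_pow, inv_pow]; field_simp; ring
      rw [e1, div_eq_mul_inv, mul_pow]
      calc _ ≤ B ^ 2 * (R ^ (n + 1) * ‖u‖⁻¹ ^ n) := by gcongr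
        _ = B ^ 2 * R * (R ^ n * ‖u‖⁻¹ ^ n) := by ring
        _ ≤ _ := by
          gcongr
          linarith
  calc _ ≤ ‖k‖ / 2 * (cylConst W Λ * Real.exp (W ^ 2) *
        (1 * ((‖k‖ / 2 * ‖u‖)⁻¹ ^ m.natAbs * (‖k‖ / 2 * ‖v‖) ^ j.natAbs))) := by
        refine mul_le_mul_of_nonneg_left (h.trans ?_) hk2.le
        gcongr
    _ = cylConst W Λ * Real.exp (W ^ 2) * (‖k‖ / 2 * ((‖k‖ / 2 * ‖u‖)⁻¹ ^ m.natAbs *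
        (‖k‖ / 2 * ‖v‖) ^ j.natAbs)) := by ring
    _ ≤ _ := by
        rw [mul_assoc (cylConst W Λ * Real.exp (W ^ 2))]
        gcongr

end TermBounds

/-! ### The two error estimates for fixed `x`, `y`, `k`. -/

section Errors

variable {k : ℂ} {xj x y : Plane} {R W Λ B : ℝ}

lemma monopoleError_le (hk : k ≠ 0) (hv : ‖y - xj‖ ≤ R) (hu : R < ‖x - xj‖)
    (hW : ‖k‖ / 2 * ‖x - xj‖ ≤ W) (hΛ : ‖waveLog k (x - xj)‖ ≤ Λ) (M : ℕ) :
    monopoleError xj M x y k ≤ cylConst W Λ * Real.exp (W ^ 2) / 2 *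
      (-Real.log (1 - R / ‖x - xj‖)
        - ∑ m ∈ Finset.Icc 1 M, (R / ‖x - xj‖) ^ m / (m : ℝ)) := by
  have hR : 0 ≤ R := (norm_nonneg _).trans hv
  have hu0 : 0 < ‖x - xj‖ := hR.trans_lt hu
  have hgraf := hasSum_graf_plane hk (hv.trans_lt hu) (n := 0) (by simp)
  simp only [zero_add, sub_sub_sub_cancel_right] at hgraf
  have htail := norm_sub_sum_Icc_le (g := fun n => cylConst W Λ * Real.exp (W ^ 2) *
    ((R / ‖x - xj‖) ^ n / (n : ℝ))) M hgraf
    ((hasSum_log_tail (div_nonneg hR hu0.le) ((div_lt_one hu0).2 hu) M).mul_left _)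
    (fun m hm => norm_monopole_term_le hk hv hu hW hΛ (by omega))
  rw [monopoleError, green_eq, greenTrunc_eq, ← mul_sub, norm_mul,
    show ‖Complex.I / 4‖ = 1 / 4 by simp]
  linarith

/-- Shifting the summation index in the expansions for `n = 1` and `n = -1` aligns both on `cyl m`;
the result matches termwise the derivative of the truncated sum. -/
lemma hasSum_graf_deriv {u v : Plane} (hk : k ≠ 0) (h : ‖v‖ < ‖u‖) (a b : ℂ) :
    HasSum (fun m : ℤ => cyl m (wave k u) (waveConj k u) (waveLog k u) *
        (b * bess (m - 1) (waveConj k v) (wave k v) - a * bess (m + 1) (waveConj k v) (wave k v)))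
      (-a * cyl (-1) (wave k (u - v)) (waveConj k (u - v)) (waveLog k (u - v))
        + b * cyl 1 (wave k (u - v)) (waveConj k (u - v)) (waveLog k (u - v))) := by
  have hs1 := ((Equiv.subRight (1 : ℤ)).hasSum_iff.2
    (hasSum_graf_plane hk h (n := 1) (by simp))).mul_left b
  have hs2 := ((Equiv.addRight (1 : ℤ)).hasSum_iff.2
    (hasSum_graf_plane hk h (n := -1) (by simp))).mul_left a
  rw [neg_mul, neg_add_eq_sub]
  refine (hs1.sub hs2).congr_fun fun m => ?_
  simp only [Function.comp, Equiv.subRight_apply, Equiv.coe_addRight]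
  rw [show 1 + (m - 1) = m by ring, show -1 + (m + 1) = m by ring]
  ring

lemma dipoleError_le (hk : k ≠ 0) (hv : ‖y - xj‖ ≤ R) (hu : R < ‖x - xj‖)
    (hW : ‖k‖ / 2 * ‖x - xj‖ ≤ W) (hΛ : ‖waveLog k (x - xj)‖ ≤ Λ) (hB : ‖k‖ / 2 ≤ B)
    {M : ℕ} (hM : 1 ≤ M) {ν : Plane} (hν : ‖ν‖ = 1) :
    dipoleError xj M x y ν k ≤ cylConst W Λ * Real.exp (W ^ 2) * (R⁻¹ + B ^ 2 * R) *
      ((R / ‖x - xj‖) ^ (M + 1) / (1 - R / ‖x - xj‖)) := by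
  have hR : 0 ≤ R := (norm_nonneg _).trans hv
  have hu0 : 0 < ‖x - xj‖ := hR.trans_lt hu
  have hlt := hv.trans_lt hu
  have hxy : x - y ≠ 0 := fun h => by rw [sub_eq_zero.1 h] at hlt; exact lt_irrefl _ hlt
  have hderiv := (hasDerivAt_green_line hk hxy ν).fun_sub
    (hasDerivAt_greenTrunc_line xj M x y ν k)
  simp only [sub_sub] at hderiv
  have hs := hasSum_graf_deriv hk hlt (wave k ν) (waveConj k ν)
  rw [sub_sub_sub_cancel_right] at hs
  set A := cylConst W Λ * Real.exp (W ^ 2) * (R⁻¹ + B ^ 2 * R)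
  have hgeo := (hasSum_geometric_tail (div_nonneg hR hu0.le)
    ((div_lt_one hu0).2 hu) M).mul_left (2 * A)
  have hterm : ∀ m : ℤ, M < m.natAbs → ‖cyl m (wave k (x - xj)) (waveConj k (x - xj))
      (waveLog k (x - xj)) * (waveConj k ν * bess (m - 1) (waveConj k (y - xj)) (wave k (y - xj))
        - wave k ν * bess (m + 1) (waveConj k (y - xj)) (wave k (y - xj)))‖ ≤
      2 * A * (R / ‖x - xj‖) ^ m.natAbs := fun m hm => by
    have h1 := norm_dipole_term_le hk hv hu hW hΛ hB (m := m) (j := m - 1) (by omega) (by omega)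
    have h2 := norm_dipole_term_le hk hv hu hW hΛ hB (m := m) (j := m + 1) (by omega) (by omega)
    rw [mul_sub, mul_left_comm, mul_left_comm (cyl m _ _ _)]
    refine (norm_sub_le _ _).trans ?_
    rw [norm_mul (waveConj k ν), norm_mul (wave k ν), norm_waveConj, norm_wave, hν, mul_one]
    linarith
  have htail := norm_sub_sum_Icc_le (g := fun n => 2 * A * (R / ‖x - xj‖) ^ n) M hs hgeo hterm
  rw [dipoleError, lineDeriv]
  beta_reduce
  rw [hderiv.deriv, ← mul_sub, norm_mul,
    show ‖Complex.I / 4‖ = 1 / 4 by simp]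
  linarith

end Errors

/-! ### Uniformity over the compact sets and conclusion. -/

lemma norm_sub_le_maxDist {xj y : Plane} {Y : Set Plane} (hY : IsCompact Y) (hy : y ∈ Y) :
    ‖y - xj‖ ≤ maxDist xj Y :=
  le_csSup (hY.image (by fun_prop)).bddAbove ⟨y, hy, rfl⟩

lemma ofReal_mul_mem_slitPlane {k : ℂ} (hk : k ∈ Complex.slitPlane) {r : ℝ} (hr : 0 < r) :
    k * (r : ℂ) / 2 ∈ Complex.slitPlane := by
  rw [show k * (r : ℂ) / 2 = ((r / 2 : ℝ) : ℂ) * k by push_cast; ring]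
  rcases hk with h | h
  · left; rw [Complex.re_ofReal_mul]; positivity
  · right; rw [Complex.im_ofReal_mul]; exact mul_ne_zero (by positivity) h

lemma exists_wave_bounds {xj : Plane} {X : Set Plane} {K : Set ℂ} (hX : IsCompact X)
    (hXj : xj ∉ X) (hK : IsCompact K) (hKslit : K ⊆ Complex.slitPlane) :
    ∃ W Λ B : ℝ, 0 ≤ Λ ∧ ∀ x ∈ X, ∀ k ∈ K,
      ‖k‖ / 2 * ‖x - xj‖ ≤ W ∧ ‖waveLog k (x - xj)‖ ≤ Λ ∧ ‖k‖ / 2 ≤ B := by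
  have hc : Continuous fun p : ℂ × Plane => p.1 * (‖p.2 - xj‖ : ℂ) / 2 := by fun_prop
  obtain ⟨W, hW⟩ := (hK.prod hX).exists_bound_of_continuousOn hc.continuousOn
  obtain ⟨Λ, hΛ⟩ := (hK.prod hX).exists_bound_of_continuousOn
    (f := fun p : ℂ × Plane => waveLog p.1 (p.2 - xj)) (hc.continuousOn.clog fun p hp =>
      ofReal_mul_mem_slitPlane (hKslit hp.1) (norm_pos_iff.2 (sub_ne_zero.2 fun h => hXj (h ▸ hp.2))))
  obtain ⟨B, hB⟩ := hK.exists_bound_of_continuousOn (f := fun k : ℂ => k / 2) (by fun_prop)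
  -- Over an empty product the bound `Λ` could be negative; the maximum keeps `cylConst` positive.
  refine ⟨W, max Λ 0, B, le_max_right _ _, fun x hx k hk => ⟨?_, ?_, ?_⟩⟩
  · refine le_trans (le_of_eq ?_) (hW (k, x) ⟨hk, hx⟩)
    rw [norm_div, norm_mul, Complex.norm_real, norm_norm, Complex.norm_ofNat]; ring
  · exact (hΛ (k, x) ⟨hk, hx⟩).trans (le_max_left _ _)
  · simpa using hB k hk

end Graf

end

theorem theorem2p1 (xj : Graf.Plane) (X Y : Set Graf.Plane) (K : Set ℂ)
    (hY : IsCompact Y) (hYne : Y.Nonempty)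
    (hX : IsCompact X) (hXdisk : X ⊆ (Graf.maxDisk xj Y)ᶜ)
    (hK : IsCompact K) (hKslit : K ⊆ Complex.slitPlane) :
    ∃ C₁ C₂ : ℝ, 0 < C₁ ∧ 0 < C₂ ∧
      ∀ M : ℕ, 2 ≤ M → ∀ x ∈ X, ∀ k ∈ K, ∀ y ∈ Y,
        Graf.monopoleError xj M x y k ≤
            C₁ * (-Real.log (1 - Graf.ratio xj Y x)
              - ∑ m ∈ Finset.Icc 1 M, Graf.ratio xj Y x ^ m / (m : ℝ)) ∧
        DifferentiableAt ℝ (fun y' : Graf.Plane => Graf.green (x - y') k) y ∧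
        DifferentiableAt ℝ (fun y' : Graf.Plane => Graf.greenTrunc xj M x y' k) y ∧
        ∀ ν : Graf.Plane, ‖ν‖ = 1 →
          Graf.dipoleError xj M x y ν k ≤
            C₂ * (Graf.ratio xj Y x ^ (M + 1) / (1 - Graf.ratio xj Y x)) := by
  obtain ⟨y₀, hy₀⟩ := hYne
  set R := Graf.maxDist xj Y with hRdef
  have hR : 0 ≤ R := (norm_nonneg _).trans (Graf.norm_sub_le_maxDist hY hy₀)
  have hXR : ∀ x ∈ X, R < ‖x - xj‖ := fun x hx => not_le.1 (hXdisk hx)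
  have hXj : xj ∉ X := fun h => by
    have := hXR xj h
    rw [sub_self, norm_zero] at this
    exact this.not_ge hR
  obtain ⟨W, Λ, B, hΛ0, hb⟩ := Graf.exists_wave_bounds hX hXj hK hKslit
  have hC : 0 < Graf.cylConst W Λ := Graf.cylConst_pos hΛ0
  -- The `1/2` is the factor `1/4` of the Green function times the two signs of `m`. The `+ 1` keeps
  -- the second constant positive when `R = 0`.
  refine ⟨Graf.cylConst W Λ * Real.exp (W ^ 2) / 2,
    Graf.cylConst W Λ * Real.exp (W ^ 2) * (R⁻¹ + B ^ 2 * R) + 1, by positivity,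
    by positivity, fun M hM x hx k hk y hy => ?_⟩
  obtain ⟨hW, hΛ, hB⟩ := hb x hx k hk
  have hv := Graf.norm_sub_le_maxDist (xj := xj) hY hy
  have hu := hXR x hx
  have hk0 : k ≠ 0 := Complex.slitPlane_ne_zero (hKslit hk)
  have hxy : x - y ≠ 0 := fun h => by
    rw [sub_eq_zero.1 h] at hu; exact hu.not_ge hv
  refine ⟨Graf.monopoleError_le hk0 hv hu hW hΛ M, Graf.differentiableAt_green hk0 hxy,
    Graf.differentiableAt_greenTrunc xj M x y k, fun ν hν => ?_⟩
  refine (Graf.dipoleError_le hk0 hv hu hW hΛ hB (by omega) hν).trans ?_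
  refine mul_le_mul_of_nonneg_right (by linarith) ?_
  have hu0 : 0 < ‖x - xj‖ := hR.trans_lt hu
  exact div_nonneg (pow_nonneg (div_nonneg hR hu0.le) _)
    (sub_nonneg.2 ((div_lt_one hu0).2 hu).le)
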